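/- All C*-algebras are complex, and a unital C*-algebra satisfies $1\neq 0$. A C*-algebra $B$ is \emph{simple} if $B\neq 0$ and its only norm-closed two-sided ideals are $\{0\}$ and $B$; a simple C*-algebra $B$ is \emph{purely infinite} if for all $a,b\in B$ with $a\neq 0$ there exist $x,y\in B$ with $xay=b$. An action $\alpha\colon\mathbb{T}\to\mathrm{Aut}(A)$ of the circle $\mathbb{T}=\{\zeta\in\mathbb{C}:|\zeta|=1\}$ on a unital C*-algebra $A$ is a group homomorphism into the $*$-automorphisms of $A$ such that $\zeta\mapsto\alpha_\zeta(a)$ is norm-continuous for every $a\in A$. It has the \emph{Rokhlin property} if for every $\varepsilon>0$ and every finite subset $F\subseteq A$ there is a unitary $u\in A$ such that $\|\alpha_\zeta(u)-\zeta u\|<\varepsilon$ for all $\zeta\in\mathbb{T}$ and $\|ua-au\|<\varepsilon$ for all $a\in F$. Write $A^\alpha=\{a\in A:\alpha_\zeta(a)=a\text{ for all }\zeta\in\mathbb{T}\}$ for the fixed point algebra, and $A\rtimes_\alpha\mathbb{T}$ for the crossed product, that is, the completion of $C(\mathbb{T},A)$, with convolution twisted by $\alpha$, in the norm $\|f\|=\sup_{(\pi,U)}\left\|\int_{\mathbb{T}}\pi(f(\zeta))U_\zeta\,d\zeta\right\|$,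 where $d\zeta$ is the normalized Haar measure and $(\pi,U)$ ranges over the covariant representations of $(A,\alpha)$ on Hilbert spaces ($\pi$ a unital $*$-representation of $A$, $U$ a strongly continuous unitary representation of $\mathbb{T}$, and $U_\zeta\pi(a)U_\zeta^*=\pi(\alpha_\zeta(a))$). \textbf{Theorem.} Let $A$ be a unital, simple, purely infinite C*-algebra, and let $\alpha\colon\mathbb{T}\to\mathrm{Aut}(A)$ be an action with the Rokhlin property. Then the fixed point algebra $A^\alpha$ and the crossed product $A\rtimes_\alpha\mathbb{T}$ are purely infinite simple C*-algebras. -/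

import Mathlib

open MeasureTheory
open scoped ENNReal

universe u

/-! ### Simple and purely infinite C⋆-algebras -/

/-- A C⋆-algebra is simple if it is nonzero and its only norm-closed two-sided ideals are `0` and
the whole algebra. -/
def IsSimpleCStarAlgebra (B : Type*) [NonUnitalCStarAlgebra B] : Prop :=
  Nontrivial B ∧ ∀ I : TwoSidedIdeal B, IsClosed (I : Set B) → I = ⊥ ∨ I = ⊤

/-- A C⋆-algebra `B` is purely infinite simple if it is simple and for all `a b : B` with `a ≠ 0`
there are `x y : B` with `x a y = b`. -/
def IsPurelyInfiniteSimple (B : Type*) [NonUnitalCStarAlgebra B] : Prop :=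
  IsSimpleCStarAlgebra B ∧ ∀ a b : B, a ≠ 0 → ∃ x y : B, x * a * y = b

/-! ### Circle actions -/

/-- A (continuous) action of the circle on the C⋆-algebra `A`: a group homomorphism into the
group of ⋆-automorphisms of `A`, continuous for the topology of pointwise norm convergence. -/
structure CircleAction (A : Type u) [CStarAlgebra A] where
  toHom : Circle →* (A ≃⋆ₐ[ℂ] A)
  continuous_apply : ∀ a : A, Continuous fun ζ : Circle => toHom ζ a

namespace CircleAction

noncomputable section

variable {A : Type u} [CStarAlgebra A]

instance : CoeFun (CircleAction A) (fun _ => Circle → (A ≃⋆ₐ[ℂ] A)) := ⟨fun α => α.toHom⟩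

/-- The Rokhlin property. -/
def HasRokhlinProperty (α : CircleAction A) : Prop :=
  ∀ ε : ℝ, 0 < ε → ∀ F : Finset A, ∃ u ∈ unitary A,
    (∀ ζ : Circle, ‖α ζ u - (ζ : ℂ) • u‖ < ε) ∧ ∀ a ∈ F, ‖u * a - a * u‖ < ε

/-- The fixed point algebra `A^α`. -/
def fixedPoints (α : CircleAction A) : StarSubalgebra ℂ A where
  carrier := {a | ∀ ζ : Circle, α ζ a = a}
  mul_mem' ha hb ζ := by rw [map_mul, ha ζ, hb ζ]
  one_mem' ζ := map_one (α ζ)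
  add_mem' ha hb ζ := by rw [map_add, ha ζ, hb ζ]
  zero_mem' ζ := map_zero (α ζ)
  algebraMap_mem' c ζ := by
    rw [Algebra.algebraMap_eq_smul_one, map_smul, map_one]
  star_mem' ha ζ := by rw [map_star, ha ζ]

instance isClosed_fixedPoints (α : CircleAction A) : IsClosed (α.fixedPoints : Set A) := by
  have h : (α.fixedPoints : Set A) = ⋂ ζ : Circle, {a | α ζ a = a} := by
    ext a
    simp [fixedPoints]
  rw [h]
  exact isClosed_iInter fun ζ =>
    isClosed_eq (AddMonoidHomClass.continuous_of_bound (α ζ) 1 fun a => by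
      simpa using NonUnitalStarAlgHom.norm_apply_le (α ζ) a) continuous_id

/-! ### The crossed product -/

instance measurableSpaceCircle : MeasurableSpace Circle := borel Circle

instance borelSpaceCircle : BorelSpace Circle := ⟨rfl⟩

/-- The normalized Haar measure on the circle. -/
def haarCircle : Measure Circle := Measure.haarMeasure ⊤

instance isProbabilityMeasure_haarCircle : IsProbabilityMeasure haarCircle :=
  ⟨Measure.haarMeasure_self⟩

/-- A covariant representation of `(A, α)`: a unital representation `π` of `A` and a strongly
continuous unitary representation `U` of the circle on a Hilbert space `H` such that
`U_ζ π(a) U_ζ⋆ = π(α_ζ(a))`. -/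
structure CovariantRep (α : CircleAction A) where
  H : Type u
  [normedAddCommGroup : NormedAddCommGroup H]
  [innerProductSpace : InnerProductSpace ℂ H]
  [completeSpace : CompleteSpace H]
  π : A →⋆ₐ[ℂ] (H →L[ℂ] H)
  U : Circle →* unitary (H →L[ℂ] H)
  continuous_U : ∀ ξ : H, Continuous fun ζ : Circle => (U ζ : H →L[ℂ] H) ξ
  covariant : ∀ (ζ : Circle) (a : A),
    (U ζ : H →L[ℂ] H) * π a * star (U ζ : H →L[ℂ] H) = π (α ζ a)

attribute [instance] CovariantRep.normedAddCommGroup CovariantRep.innerProductSpace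
  CovariantRep.completeSpace

namespace CovariantRep

variable {α : CircleAction A} (ρ : CovariantRep α)

theorem continuous_integrand (f : C(Circle, A)) (ξ : ρ.H) :
    Continuous fun ζ : Circle => ρ.π (f ζ) ((ρ.U ζ : ρ.H →L[ℂ] ρ.H) ξ) := by
  have hπ : Continuous ρ.π :=
    AddMonoidHomClass.continuous_of_bound ρ.π 1 fun a => by
      simpa using NonUnitalStarAlgHom.norm_apply_le ρ.π a
  exact (hπ.comp f.continuous).clm_apply (ρ.continuous_U ξ)

theorem integrable_integrand (f : C(Circle, A)) (ξ : ρ.H) :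
    Integrable (fun ζ : Circle => ρ.π (f ζ) ((ρ.U ζ : ρ.H →L[ℂ] ρ.H) ξ)) haarCircle :=
  (ρ.continuous_integrand f ξ).integrable_of_hasCompactSupport
    (HasCompactSupport.of_compactSpace _)

theorem norm_integrand_le (f : C(Circle, A)) (ξ : ρ.H) (ζ : Circle) :
    ‖ρ.π (f ζ) ((ρ.U ζ : ρ.H →L[ℂ] ρ.H) ξ)‖ ≤ ‖f‖ * ‖ξ‖ := by
  have h1 : ‖ρ.π (f ζ)‖ ≤ ‖f‖ :=
    (NonUnitalStarAlgHom.norm_apply_le ρ.π (f ζ)).trans (f.norm_coe_le_norm ζ)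
  have h2 : ‖(ρ.U ζ : ρ.H →L[ℂ] ρ.H) ξ‖ ≤ ‖ξ‖ :=
    (ContinuousLinearMap.norm_map_of_mem_unitary (ρ.U ζ).2 ξ).le
  exact ContinuousLinearMap.le_of_opNorm_le_of_le _ h1 h2

/-- The integrated form `(π ⋊ U)(f) = ∫ π(f(ζ)) U_ζ dζ`, as a strong integral. -/
def integrated (f : C(Circle, A)) : ρ.H →L[ℂ] ρ.H :=
  LinearMap.mkContinuous
    { toFun := fun ξ => ∫ ζ, ρ.π (f ζ) ((ρ.U ζ : ρ.H →L[ℂ] ρ.H) ξ) ∂haarCircle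
      map_add' := fun ξ η => by
        simp only [map_add]
        exact integral_add (ρ.integrable_integrand f ξ) (ρ.integrable_integrand f η)
      map_smul' := fun c ξ => by
        simp only [map_smul, RingHom.id_apply]
        exact integral_smul c _ }
    ‖f‖ fun ξ => by
      simpa using norm_integral_le_of_norm_le_const (μ := haarCircle)
        (Filter.Eventually.of_forall (ρ.norm_integrand_le f ξ))

theorem norm_integrated_le (f : C(Circle, A)) : ‖ρ.integrated f‖ ≤ ‖f‖ :=
  LinearMap.mkContinuous_norm_le _ (norm_nonneg f) _

end CovariantRep

/-- The family of the integrated forms of `f ∈ C(𝕋, A)` in all covariant representations, as an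
element of the `ℓ^∞`-product of the algebras of bounded operators. Its norm is the universal norm
`‖f‖ = sup ‖(π ⋊ U)(f)‖`, the supremum over all covariant representations `(π, U)`. -/
def universalRep (α : CircleAction A) (f : C(Circle, A)) :
    lp (fun ρ : CovariantRep α => ρ.H →L[ℂ] ρ.H) ∞ :=
  ⟨fun ρ => ρ.integrated f, memℓp_infty ⟨‖f‖, by
    rintro _ ⟨ρ, rfl⟩
    exact ρ.norm_integrated_le f⟩⟩

/-- The (full) crossed product `A ⋊_α 𝕋`: the completion of `C(𝕋, A)` in the universal norm,
realized as the C⋆-algebra generated by the universal integrated forms of the elements of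
`C(𝕋, A)`. -/
def crossedProduct (α : CircleAction A) :
    NonUnitalStarSubalgebra ℂ (lp (fun ρ : CovariantRep α => ρ.H →L[ℂ] ρ.H) ∞) :=
  (NonUnitalStarAlgebra.adjoin ℂ (Set.range α.universalRep)).topologicalClosure

instance isClosed_crossedProduct (α : CircleAction A) :
    IsClosed (α.crossedProduct : Set (lp (fun ρ : CovariantRep α => ρ.H →L[ℂ] ρ.H) ∞)) :=
  NonUnitalStarSubalgebra.isClosed_topologicalClosure _

end

end CircleAction

namespace CircleAction

/-! ### Fourier analysis on the circle -/

section Fourier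

/-! The Rokhlin property yields exact eigenunitaries: averaging `ζ⁻¹ α_ζ(u)` over the circle moves
an approximate eigenunitary `u` slightly into the first spectral subspace, and a polar decomposition
makes it unitary again (`exists_eigenunitary_near`). Hence there is an asymptotically central net
`v_i` of unitaries with `α_ζ(v_i) = ζ v_i`.

For the fixed point algebra, send a trigonometric polynomial `∑ ζ^n a_n` to `∑ a_n v_i^(-n)`.
Asymptotic centrality makes this map asymptotically multiplicative, star preserving and contractive
(`eventually_norm_evalInv_lt`). On orbit maps `ζ ↦ α_ζ(a)` it takes values in `A^α`, and it returns
`a` when `a` is already fixed. A relation `x a y = 1` in `A` with `a` fixed is thus transported, up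
to a small error, to a relation in `A^α`, and invertibility of elements near `1` finishes
(`exists_mul_mul_eq_one`).

For the crossed product, fix one eigenunitary `v`. If `p_j` is the projection onto the
`ζ^j`-isotypic part of `U`, the elements `π(v^i d v^(-j)) p_j` with `d` in `A^α` multiply like
matrices over `A^α` indexed by the integers, and they span a dense subspace: the crossed product is
a stabilization of `A^α`. Pure infiniteness passes to it in two steps. A nonzero element has a
nonzero matrix entry, which can be cut down to the unit of a corner. Conversely, every element
factors through that corner, by means of infinitely many isometries in `A^α` with orthogonal ranges
(`exists_mul_entry_mul_eq`). Such isometries exist because `A^α` is not scalar. The corner is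
nonzero because the GNS representation of an invariant state has a nonzero invariant vector. -/

instance isHaarMeasure_haarCircle : haarCircle.IsHaarMeasure := by
  unfold haarCircle; infer_instance

theorem integrable_of_continuous {E : Type*} [NormedAddCommGroup E] {f : Circle → E}
    (hf : Continuous f) : Integrable f haarCircle :=
  hf.integrable_of_hasCompactSupport (HasCompactSupport.of_compactSpace _)

/-- The character `ζ ↦ ζ ^ n` of the circle. -/
noncomputable def character (n : ℤ) : C(Circle, ℂ) :=
  ⟨fun ζ => (ζ : ℂ) ^ n, by
    have : (fun ζ : Circle => (ζ : ℂ) ^ n) = fun ζ : Circle => ((ζ ^ n : Circle) : ℂ) := by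
      ext; simp
    rw [this]
    exact continuous_subtype_val.comp (continuous_zpow n)⟩

@[simp]
theorem character_apply (n : ℤ) (ζ : Circle) : character n ζ = (ζ : ℂ) ^ n := rfl

theorem norm_zpow_coe (ζ : Circle) (n : ℤ) : ‖(ζ : ℂ) ^ n‖ = 1 := by
  rw [norm_zpow, Circle.norm_coe, one_zpow]

/-- The linear span of the characters, as a star subalgebra of `C(𝕋)`. -/
noncomputable def trigPolynomials : StarSubalgebra ℂ C(Circle, ℂ) where
  toSubalgebra := Algebra.adjoin ℂ (Set.range character)
  star_mem' := by
    change Algebra.adjoin ℂ (Set.range character) ≤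
      star (Algebra.adjoin ℂ (Set.range character))
    refine Algebra.adjoin_le ?_
    rintro - ⟨n, rfl⟩
    refine Algebra.subset_adjoin ⟨-n, ?_⟩
    ext ζ
    simp [← Circle.coe_inv_eq_conj]

theorem trigPolynomials_toSubmodule :
    Subalgebra.toSubmodule trigPolynomials.toSubalgebra =
      Submodule.span ℂ (Set.range character) := by
  apply Algebra.adjoin_eq_span_of_subset
  refine Set.Subset.trans ?_ Submodule.subset_span
  intro x hx
  refine Submonoid.closure_induction (fun _ => id) ⟨0, ?_⟩ ?_ hx
  · ext; simp
  · rintro _ _ _ _ ⟨m, rfl⟩ ⟨n, rfl⟩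
    refine ⟨m + n, ?_⟩
    ext ζ
    simp [zpow_add₀]

theorem dense_span_character :
    Dense (Submodule.span ℂ (Set.range character) : Set C(Circle, ℂ)) := by
  have h := ContinuousMap.starSubalgebra_topologicalClosure_eq_top_of_separatesPoints
    trigPolynomials (by
      intro x y hxy
      refine ⟨_, ⟨character 1, Algebra.subset_adjoin ⟨1, rfl⟩, rfl⟩, ?_⟩
      simpa [Circle.coe_inj] using hxy)
  rw [← trigPolynomials_toSubmodule]
  intro f
  have : f ∈ trigPolynomials.topologicalClosure := by rw [h]; trivial
  exact this

theorem integral_zpow_eq_zero {n : ℤ} (hn : n ≠ 0) : ∫ ζ : Circle, (ζ : ℂ) ^ n ∂haarCircle = 0 := by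
  obtain ⟨η, hη⟩ : ∃ η : Circle, (η : ℂ) ^ n ≠ 1 := by
    -- Here `η ^ n = e^i`, whose real part `cos 1` is less than `1`.
    refine ⟨Circle.exp (1 / n), ?_⟩
    rw [Circle.coe_exp, ← Complex.exp_int_mul]
    have hn' : (n : ℂ) ≠ 0 := by exact_mod_cast hn
    have : (n : ℂ) * (((1 / n : ℝ) : ℂ) * Complex.I) = Complex.I := by
      push_cast; field_simp
    rw [this]
    intro h
    have := congrArg Complex.re h
    rw [Complex.exp_re] at this
    simp only [Complex.I_re, Real.exp_zero, Complex.I_im, one_mul, Complex.one_re] at this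
    have h1 := Real.cos_one_le
    linarith
  have h := integral_mul_left_eq_self (μ := haarCircle) (fun ζ : Circle => (ζ : ℂ) ^ n) η
  simp only [Circle.coe_mul, mul_zpow, integral_const_mul] at h
  have : ((η : ℂ) ^ n - 1) * ∫ ζ : Circle, (ζ : ℂ) ^ n ∂haarCircle = 0 := by
    rw [sub_mul, h, one_mul, sub_self]
  exact (mul_eq_zero.mp this).resolve_left (sub_ne_zero.mpr hη)

theorem integral_zpow (n : ℤ) :
    ∫ ζ : Circle, (ζ : ℂ) ^ n ∂haarCircle = if n = 0 then 1 else 0 := by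
  split_ifs with h
  · simp [h]
  · exact integral_zpow_eq_zero h

variable {E : Type*} [NormedAddCommGroup E] [NormedSpace ℂ E] [CompleteSpace E]

/-- If a closed subspace contains all Fourier coefficients of a continuous function on the circle,
then it contains the value of the function at the identity. -/
theorem apply_one_mem_of_fourier_mem (M : Submodule ℂ E) (hM : IsClosed (M : Set E))
    {f : Circle → E} (hf : Continuous f)
    (h : ∀ n : ℤ, ∫ ζ : Circle, (ζ : ℂ) ^ n • f ζ ∂haarCircle ∈ M) : f 1 ∈ M := by
  have hint : ∀ k : C(Circle, ℂ), Integrable (fun ζ => k ζ • f ζ) haarCircle := fun k =>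
    integrable_of_continuous (k.continuous.smul hf)
  have key : ∀ k : C(Circle, ℂ), ∫ ζ : Circle, k ζ • f ζ ∂haarCircle ∈ M := by
    let L : C(Circle, ℂ) →ₗ[ℂ] E :=
      { toFun := fun k => ∫ ζ : Circle, k ζ • f ζ ∂haarCircle
        map_add' := fun k l => by
          simp only [ContinuousMap.add_apply, add_smul]
          exact integral_add (hint k) (hint l)
        map_smul' := fun c k => by
          simp only [ContinuousMap.smul_apply, smul_assoc, RingHom.id_apply]
          exact integral_smul c _ }
    let F : C(Circle, E) := ⟨f, hf⟩
    have hL : Continuous L := by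
      refine AddMonoidHomClass.continuous_of_bound L ‖F‖ fun k => ?_
      have := norm_integral_le_of_norm_le_const (μ := haarCircle) (f := fun ζ => k ζ • f ζ)
        (C := ‖F‖ * ‖k‖) (Filter.Eventually.of_forall fun ζ => by
          rw [norm_smul, mul_comm]
          exact mul_le_mul (F.norm_coe_le_norm ζ) (k.norm_coe_le_norm ζ) (norm_nonneg _)
            (norm_nonneg _))
      simpa [L] using this
    have hsub : Submodule.span ℂ (Set.range character) ≤ M.comap L := by
      rw [Submodule.span_le]
      rintro - ⟨n, rfl⟩
      exact h n
    intro k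
    have hk := dense_span_character k
    exact closure_minimal hsub (hM.preimage hL) hk
  rw [← SetLike.mem_coe, ← hM.closure_eq, Metric.mem_closure_iff]
  intro ε hε
  obtain ⟨δ, hδ, hδf⟩ := Metric.continuousAt_iff.mp hf.continuousAt (ε / 2) (half_pos hε)
  let k : C(Circle, ℝ) := ⟨fun ζ => max 0 (δ - dist ζ 1), by fun_prop⟩
  have hk0 : ∀ ζ, 0 ≤ k ζ := fun ζ => le_max_left _ _
  have hkpos : 0 < ∫ ζ, k ζ ∂haarCircle := by
    refine Continuous.integral_pos_of_hasCompactSupport_nonneg_nonzero (x := 1) k.continuous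
      (HasCompactSupport.of_compactSpace _) hk0 ?_
    simp [k, hδ.ne', hδ.le]
  set c := ∫ ζ, k ζ ∂haarCircle with hc
  let kc : C(Circle, ℂ) := ⟨fun ζ => ((k ζ : ℝ) : ℂ), by fun_prop⟩
  refine ⟨(c⁻¹ : ℂ) • ∫ ζ : Circle, kc ζ • f ζ ∂haarCircle, M.smul_mem _ (key kc), ?_⟩
  have hc1 : f 1 = (c⁻¹ : ℂ) • ∫ ζ : Circle, kc ζ • f 1 ∂haarCircle := by
    rw [integral_smul_const]
    have : ∫ ζ, kc ζ ∂haarCircle = (c : ℂ) := integral_ofReal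
    rw [this, smul_smul, inv_mul_cancel₀ (by exact_mod_cast hkpos.ne'), one_smul]
  have hdiff : ‖∫ ζ : Circle, (kc ζ • f 1 - kc ζ • f ζ) ∂haarCircle‖ ≤ c * (ε / 2) := by
    rw [hc, ← integral_mul_const]
    refine norm_integral_le_of_norm_le
      (integrable_of_continuous (k.continuous.mul continuous_const)) (.of_forall fun ζ => ?_)
    rw [← smul_sub, norm_smul]
    have : ‖kc ζ‖ = k ζ := by simp [kc, abs_of_nonneg (hk0 ζ)]
    rw [this]
    by_cases hζ : dist ζ 1 < δ
    · refine mul_le_mul_of_nonneg_left ?_ (hk0 ζ)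
      rw [← dist_eq_norm, dist_comm]
      exact (hδf hζ).le
    · have : k ζ = 0 := by simp only [k, ContinuousMap.coe_mk]; exact max_eq_left (by linarith)
      simp [this]
  rw [dist_eq_norm]
  nth_rewrite 1 [hc1]
  rw [← smul_sub, ← integral_sub, norm_smul]
  · calc _ ≤ c⁻¹ * (c * (ε / 2)) := by
          rw [norm_inv, Complex.norm_real, Real.norm_of_nonneg hkpos.le]
          gcongr
      _ = ε / 2 := by field_simp
      _ < ε := half_lt_self hε
  · exact integrable_of_continuous (kc.continuous.smul continuous_const)
  · exact hint kc

end Fourier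

end CircleAction

namespace CircleAction

variable {A : Type u} [CStarAlgebra A] (α : CircleAction A)

/-! ### Spectral subspaces -/

theorem norm_apply (ζ : Circle) (a : A) : ‖α ζ a‖ = ‖a‖ :=
  NonUnitalStarAlgHom.norm_map (α ζ) (α ζ).injective a

theorem continuous_automorphism (ζ : Circle) : Continuous (α ζ) :=
  AddMonoidHomClass.continuous_of_bound (α ζ) 1 fun a => by rw [norm_apply, one_mul]

theorem apply_mul_apply (ζ η : Circle) (a : A) : α (ζ * η) a = α ζ (α η a) := by
  rw [map_mul]; rfl

/-- The spectral subspace of `α` for the character `ζ ↦ ζ ^ n`. -/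
def spectralSubspace (n : ℤ) : Submodule ℂ A where
  carrier := {a | ∀ ζ : Circle, α ζ a = (ζ : ℂ) ^ n • a}
  add_mem' ha hb ζ := by rw [map_add, ha ζ, hb ζ, smul_add]
  zero_mem' ζ := by simp
  smul_mem' c a ha ζ := by rw [map_smul, ha ζ, smul_comm]

variable {α} in
theorem mul_mem_spectralSubspace {m n : ℤ} {a b : A} (ha : a ∈ α.spectralSubspace m)
    (hb : b ∈ α.spectralSubspace n) : a * b ∈ α.spectralSubspace (m + n) := fun ζ => by
  rw [map_mul, ha ζ, hb ζ, smul_mul_smul_comm, zpow_add₀ (Circle.coe_ne_zero ζ)]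

variable {α} in
theorem star_mem_spectralSubspace {n : ℤ} {a : A} (ha : a ∈ α.spectralSubspace n) :
    star a ∈ α.spectralSubspace (-n) := fun ζ => by
  rw [map_star, ha ζ, star_smul]
  congr 1
  rw [star_zpow₀, zpow_neg, ← inv_zpow, ← Circle.coe_inv, Circle.coe_inv_eq_conj]
  rfl

theorem mem_spectralSubspace_zero {a : A} : a ∈ α.spectralSubspace 0 ↔ a ∈ α.fixedPoints := by
  constructor
  · intro h ζ
    simpa using h ζ
  · intro h ζ
    simpa using h ζ

theorem one_mem_spectralSubspace : (1 : A) ∈ α.spectralSubspace 0 :=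
  α.mem_spectralSubspace_zero.mpr (one_mem _)

theorem continuous_zpow_smul (n : ℤ) (a : A) :
    Continuous fun ζ : Circle => (ζ : ℂ) ^ n • α ζ a :=
  (character n).continuous.smul (α.continuous_apply a)

/-- The Fourier coefficients of the orbit map lie in the spectral subspaces. -/
theorem integral_mem_spectralSubspace (n : ℤ) (a : A) :
    ∫ ζ : Circle, (ζ : ℂ) ^ n • α ζ a ∂haarCircle ∈ α.spectralSubspace (-n) := fun η => by
  let L : A →L[ℂ] A := ⟨(α η : A →ₗ[ℂ] A), α.continuous_automorphism η⟩
  have h1 : α η (∫ ζ : Circle, (ζ : ℂ) ^ n • α ζ a ∂haarCircle) =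
      ∫ ζ : Circle, (ζ : ℂ) ^ n • α (η * ζ) a ∂haarCircle := by
    have := L.integral_comp_comm (integrable_of_continuous (α.continuous_zpow_smul n a))
    refine this.symm.trans (integral_congr_ae (.of_forall fun ζ => ?_))
    beta_reduce
    rw [apply_mul_apply]
    exact map_smul (α η) _ _
  have h2 := integral_mul_left_eq_self (μ := haarCircle)
    (fun ζ : Circle => (ζ : ℂ) ^ n • α ζ a) η
  rw [h1, ← h2, ← integral_smul]
  refine integral_congr_ae (.of_forall fun ζ => ?_)
  simp only [Circle.coe_mul, mul_zpow, smul_smul]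
  rw [← mul_assoc, ← zpow_add₀ (Circle.coe_ne_zero η), neg_add_cancel, zpow_zero, one_mul]

/-- The algebraic span of the spectral subspaces is dense. -/
theorem dense_iSup_spectralSubspace :
    Dense ((⨆ n, α.spectralSubspace n : Submodule ℂ A) : Set A) := by
  intro a
  have := apply_one_mem_of_fourier_mem (⨆ n, α.spectralSubspace n).topologicalClosure
    (Submodule.isClosed_topologicalClosure _) (α.continuous_apply a) fun n =>
      Submodule.le_topologicalClosure _
        (Submodule.mem_iSup_of_mem (-n) (α.integral_mem_spectralSubspace n a))
  rw [map_one] at this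
  exact this

/-! ### Eigenunitaries -/

/-- The unitaries `v` with `α_ζ(v) = ζ v` for all `ζ`. -/
def eigenunitaries : Set (unitary A) := {v | (v : A) ∈ α.spectralSubspace 1}

variable {α} in
theorem zpow_mem_spectralSubspace {v : unitary A} (hv : v ∈ α.eigenunitaries) (n : ℤ) :
    ((v ^ n : unitary A) : A) ∈ α.spectralSubspace n := by
  have hnat : ∀ n : ℕ, ((v ^ n : unitary A) : A) ∈ α.spectralSubspace n := by
    intro n
    induction n with
    | zero => simpa using α.one_mem_spectralSubspace
    | succ n ih =>
      rw [pow_succ]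
      exact_mod_cast mul_mem_spectralSubspace ih hv
  cases n with
  | ofNat n => simpa using hnat n
  | negSucc n =>
    rw [zpow_negSucc, ← Unitary.star_eq_inv, Unitary.coe_star]
    exact star_mem_spectralSubspace (hnat (n + 1))


end CircleAction

/-! ### Inverse square roots near the unit -/

section CStarAlgebra

variable {C : Type*} [CStarAlgebra C]

theorem abs_sub_one_le_of_mem_spectrum [Nontrivial C] {h : C} {x : ℝ} (hx : x ∈ spectrum ℝ h) :
    |x - 1| ≤ ‖h - 1‖ := by
  have h1 : x - 1 ∈ spectrum ℝ (h - 1) := by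
    have := spectrum.sub_singleton_eq (R := ℝ) h 1
    rw [map_one] at this
    rw [← this]
    exact Set.sub_mem_sub hx rfl
  simpa using spectrum.norm_le_norm_of_mem h1

/-- A self-adjoint element close to `1` has an inverse square root close to `1`. -/
theorem exists_inv_sqrt_near_one [Nontrivial C] {h : C} (hh : IsSelfAdjoint h)
    (hlt : ‖h - 1‖ ≤ 1 / 2) :
    ∃ r : C, IsSelfAdjoint r ∧ r * h * r = 1 ∧ ‖r - 1‖ ≤ ‖h - 1‖ := by
  set δ := ‖h - 1‖ with hδ
  have hδ0 : 0 ≤ δ := norm_nonneg _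
  have hspec : ∀ x ∈ spectrum ℝ h, 1 - δ ≤ x ∧ x ≤ 1 + δ := fun x hx => by
    have := abs_le.mp (abs_sub_one_le_of_mem_spectrum hx)
    constructor <;> linarith
  have hcont : ContinuousOn (fun x : ℝ => (√x)⁻¹) (spectrum ℝ h) := by
    refine ContinuousOn.inv₀ Real.continuous_sqrt.continuousOn fun x hx => ?_
    exact (Real.sqrt_pos.mpr (by linarith [(hspec x hx).1])).ne'
  refine ⟨cfc (fun x : ℝ => (√x)⁻¹) h, cfc_predicate _ h, ?_, ?_⟩
  · nth_rewrite 2 [← cfc_id' ℝ h]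
    rw [← cfc_mul _ _ h hcont, ← cfc_mul (fun x : ℝ => (√x)⁻¹ * x) _ h
      (hcont.mul (continuousOn_id' _)) hcont]
    rw [← cfc_one ℝ h]
    refine cfc_congr fun x hx => ?_
    have hx0 : 0 < x := by linarith [(hspec x hx).1]
    have := Real.mul_self_sqrt hx0.le
    have h2 : √x ≠ 0 := (Real.sqrt_pos.mpr hx0).ne'
    simp only [Pi.one_apply]
    field_simp
    nlinarith
  · rw [← cfc_one ℝ h, ← cfc_sub _ _ h hcont (by fun_prop)]
    refine norm_cfc_le hδ0 fun x hx => ?_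
    obtain ⟨h1, h2⟩ := hspec x hx
    have hx0 : 0 < x := by linarith
    have hs := Real.sqrt_pos.mpr hx0
    have hsq := Real.sq_sqrt hx0.le
    rw [Real.norm_eq_abs, abs_le, Pi.one_apply]
    have e : (√x)⁻¹ - 1 = (1 - √x) / √x := by field_simp
    rw [e, le_div_iff₀ hs, div_le_iff₀ hs]
    constructor
    · nlinarith [mul_nonneg hδ0 hs.le]
    -- The bound amounts to `(1 + δ)² (1 - δ) ≥ 1`, that is `δ + δ² ≤ 1` for `δ > 0`, which `δ ≤ 1 /
    -- 2` ensures.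
    · by_contra hcon
      push Not at hcon
      nlinarith [mul_pos hs hs, mul_nonneg hδ0 hs.le, sq_nonneg (√x * (1 + δ) - 1)]

end CStarAlgebra

/-! ### Exact eigenunitaries -/

namespace CircleAction

variable {A : Type u} [CStarAlgebra A] (α : CircleAction A)

/-- The average `w` of `ζ⁻¹ α_ζ(u)` is an exact eigenvector within `ε` of `u`. As `star w * w` is
fixed by the action, so is its inverse square root `r`, and `w * r` is the required unitary. -/
theorem exists_eigenunitary_near [Nontrivial A] {u : A} (hu : u ∈ unitary A) {ε : ℝ}
    (hε : ε ≤ 1 / 8) (h : ∀ ζ : Circle, ‖α ζ u - (ζ : ℂ) • u‖ < ε) :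
    ∃ v ∈ α.eigenunitaries, ‖(v : A) - u‖ ≤ 8 * ε := by
  have hε0 : 0 < ε := (norm_nonneg _).trans_lt (h 1)
  have hun : ‖u‖ = 1 := CStarRing.norm_of_mem_unitary hu
  set w := ∫ ζ : Circle, (ζ : ℂ) ^ (-1 : ℤ) • α ζ u ∂haarCircle with hw
  have hw1 : w ∈ α.spectralSubspace 1 := α.integral_mem_spectralSubspace (-1) u
  have hwu : ‖w - u‖ ≤ ε := by
    have : w - u = ∫ ζ : Circle, ((ζ : ℂ) ^ (-1 : ℤ) • α ζ u - u) ∂haarCircle := by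
      rw [integral_sub (integrable_of_continuous (α.continuous_zpow_smul _ _))
        (integrable_const _)]
      simp [hw]
    rw [this]
    refine (norm_integral_le_of_norm_le_const (C := ε) (.of_forall fun ζ => ?_)).trans (by simp)
    have e : (ζ : ℂ) ^ (-1 : ℤ) • α ζ u - u = (ζ : ℂ) ^ (-1 : ℤ) • (α ζ u - (ζ : ℂ) • u) := by
      rw [smul_sub, smul_smul, zpow_neg_one, inv_mul_cancel₀ (Circle.coe_ne_zero ζ), one_smul]
    rw [e, norm_smul, norm_zpow_coe, one_mul]
    exact (h ζ).le
  have hwn : ‖w‖ ≤ 1 + ε := by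
    calc ‖w‖ = ‖u + (w - u)‖ := by congr 1; abel
      _ ≤ 1 + ε := (norm_add_le _ _).trans (by rw [hun]; gcongr)
  have hmem : star w * w ∈ α.fixedPoints := by
    rw [← mem_spectralSubspace_zero]
    simpa using mul_mem_spectralSubspace (star_mem_spectralSubspace hw1) hw1
  -- Taking the functional calculus inside the fixed point algebra makes `r` invariant
  -- automatically.
  let k : α.fixedPoints := ⟨star w * w, hmem⟩
  have hk1 : ‖k - 1‖ ≤ 3 * ε := by
    change ‖star w * w - 1‖ ≤ _
    have : star w * w - 1 = star (w - u) * w + star u * (w - u) := by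
      rw [star_sub, sub_mul, mul_sub, (Unitary.mem_iff.mp hu).1]; abel
    rw [this]
    calc _ ≤ ‖star (w - u)‖ * ‖w‖ + ‖star u‖ * ‖w - u‖ :=
          (norm_add_le _ _).trans (add_le_add (norm_mul_le _ _) (norm_mul_le _ _))
      _ ≤ ε * (1 + ε) + 1 * ε := by
          rw [norm_star, norm_star, hun]; gcongr
      _ ≤ 3 * ε := by nlinarith
  have hksa : IsSelfAdjoint k := Subtype.ext (by simp [k])
  obtain ⟨r, hr, hrk, hr1⟩ := exists_inv_sqrt_near_one hksa (hk1.trans (by linarith))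
  have hrk' : (r : A) * (star w * w) * r = 1 := congrArg Subtype.val hrk
  have hr' : star (r : A) = r := congrArg Subtype.val hr
  have hr1' : ‖(r : A) - 1‖ ≤ 3 * ε := (hr1.trans hk1 : ‖r - 1‖ ≤ _)
  have hvu : ‖w * (r : A) - u‖ ≤ 8 * ε := by
    have : w * (r : A) - u = w * ((r : A) - 1) + (w - u) := by rw [mul_sub, mul_one]; abel
    rw [this]
    calc _ ≤ ‖w‖ * ‖(r : A) - 1‖ + ‖w - u‖ :=
          (norm_add_le _ _).trans (add_le_add (norm_mul_le _ _) le_rfl)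
      _ ≤ (1 + ε) * (3 * ε) + ε := by gcongr
      _ ≤ 8 * ε := by nlinarith
  have hvv : star (w * (r : A)) * (w * r) = 1 := by
    rw [star_mul, hr', ← hrk']; simp only [mul_assoc]
  -- An invertible isometry is unitary; both factors are invertible, being close to `u` and to `1`.
  have hunit : IsUnit (w * (r : A)) := by
    have hwunit : IsUnit w := by
      have : IsUnit (star u * w) := by
        have hlt : ‖1 - star u * w‖ < 1 := by
          have : 1 - star u * w = star u * (u - w) := by
            rw [mul_sub, (Unitary.mem_iff.mp hu).1]
          rw [this]
          refine (norm_mul_le _ _).trans_lt ?_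
          rw [norm_star, hun, norm_sub_rev]; linarith
        have := isUnit_one_sub_of_norm_lt_one hlt
        simpa using this
      have h2 : w = u * (star u * w) := by
        rw [← mul_assoc, (Unitary.mem_iff.mp hu).2, one_mul]
      rw [h2]
      exact IsUnit.mul ⟨⟨u, star u, (Unitary.mem_iff.mp hu).2, (Unitary.mem_iff.mp hu).1⟩, rfl⟩ this
    have hrunit : IsUnit (r : A) := by
      have hlt : ‖1 - (r : A)‖ < 1 := by rw [norm_sub_rev]; linarith
      simpa using isUnit_one_sub_of_norm_lt_one hlt
    exact hwunit.mul hrunit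
  have hvv' : (w * (r : A)) * star (w * (r : A)) = 1 := by
    obtain ⟨x, hx⟩ := hunit
    rw [← hx] at hvv ⊢
    rw [← Units.inv_eq_of_mul_eq_one_left hvv]
    simp
  refine ⟨⟨w * r, Unitary.mem_iff.mpr ⟨hvv, hvv'⟩⟩, ?_, hvu⟩
  have := mul_mem_spectralSubspace hw1 (α.mem_spectralSubspace_zero.mpr r.2)
  rwa [add_zero] at this

variable {α} in
/-- Under the Rokhlin property the approximate eigenunitaries may be chosen exact. -/
theorem HasRokhlinProperty.exists_eigenunitary [Nontrivial A] (hα : α.HasRokhlinProperty)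
    {ε : ℝ} (hε : 0 < ε) (F : Finset A) :
    ∃ v ∈ α.eigenunitaries, ∀ a ∈ F, ‖(v : A) * a - a * v‖ < ε := by
  set K : ℝ := 1 + ∑ a ∈ F, ‖a‖ with hK
  have hK1 : 1 ≤ K := le_add_of_nonneg_right (Finset.sum_nonneg fun _ _ => norm_nonneg _)
  have hFK : ∀ a ∈ F, ‖a‖ ≤ K := fun a ha =>
    (Finset.single_le_sum (f := fun a => ‖a‖) (fun _ _ => norm_nonneg _) ha).trans (by linarith)
  -- The bound `1 / 8` permits the correction of `u` to `v`; the total commutator error is `δ + 16 δ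
  -- K ≤ 17 δ K < ε`.
  set δ : ℝ := min (1 / 8) (ε / (32 * K)) with hδ
  have hδ0 : 0 < δ := by positivity
  have hδK : δ * (32 * K) ≤ ε := (le_div_iff₀ (by positivity)).mp (min_le_right _ _)
  obtain ⟨u, hu, h1, h2⟩ := hα δ hδ0 F
  obtain ⟨v, hv, hvu⟩ := α.exists_eigenunitary_near hu (min_le_left _ _) h1
  refine ⟨v, hv, fun a ha => ?_⟩
  have : (v : A) * a - a * v = (u * a - a * u) + (((v : A) - u) * a - a * ((v : A) - u)) := by
    noncomm_ring
  rw [this]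
  calc _ ≤ ‖u * a - a * u‖ + (‖(v : A) - u‖ * ‖a‖ + ‖a‖ * ‖(v : A) - u‖) :=
        (norm_add_le _ _).trans (add_le_add le_rfl
          ((norm_sub_le _ _).trans (add_le_add (norm_mul_le _ _) (norm_mul_le _ _))))
    _ ≤ δ + (8 * δ * K + K * (8 * δ)) := by
        have := (h2 a ha).le
        have := hFK a ha
        gcongr
    _ < ε := by nlinarith

end CircleAction

namespace CircleAction

open Filter Topology

/-! ### Trigonometric polynomials with coefficients in a C⋆-algebra -/

section TrigPolynomials

variable {A : Type u} [CStarAlgebra A]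

/-- The function `ζ ↦ ζ ^ n • a`. -/
noncomputable def monomial (n : ℤ) (a : A) : C(Circle, A) :=
  ⟨fun ζ => (ζ : ℂ) ^ n • a, (character n).continuous.smul continuous_const⟩

@[simp]
theorem monomial_apply (n : ℤ) (a : A) (ζ : Circle) : monomial n a ζ = (ζ : ℂ) ^ n • a := rfl

theorem monomial_mul (m n : ℤ) (a b : A) :
    monomial m a * monomial n b = monomial (m + n) (a * b) := by
  ext ζ
  simp [zpow_add₀, smul_smul, mul_comm]

theorem star_monomial (n : ℤ) (a : A) : star (monomial n a) = monomial (-n) (star a) := by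
  ext ζ
  simp [← Circle.coe_inv_eq_conj]

/-- Trigonometric polynomials of degree at most `N` with coefficients in `A`. -/
noncomputable def trigPolynomialsOfDegree (A : Type u) [CStarAlgebra A] (N : ℕ) :
    Submodule ℂ C(Circle, A) :=
  Submodule.span ℂ {f | ∃ (n : ℤ) (a : A), n ∈ Finset.Icc (-N : ℤ) N ∧ monomial n a = f}

theorem monomial_mem_trigPolynomialsOfDegree {N : ℕ} {n : ℤ} (hn : n ∈ Finset.Icc (-N : ℤ) N)
    (a : A) : monomial n a ∈ trigPolynomialsOfDegree A N :=
  Submodule.subset_span ⟨n, a, hn, rfl⟩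

theorem trigPolynomialsOfDegree_mono {M N : ℕ} (h : M ≤ N) :
    trigPolynomialsOfDegree A M ≤ trigPolynomialsOfDegree A N := by
  refine Submodule.span_mono ?_
  rintro - ⟨n, a, hn, rfl⟩
  refine ⟨n, a, ?_, rfl⟩
  rw [Finset.mem_Icc] at hn ⊢
  omega

theorem integrable_continuousMap (n : ℤ) (f : C(Circle, A)) :
    Integrable (fun ζ : Circle => (ζ : ℂ) ^ n • f ζ) haarCircle :=
  integrable_of_continuous ((character n).continuous.smul f.continuous)

/-- The `n`-th Fourier coefficient. -/
noncomputable def fourierCoefficient (n : ℤ) : C(Circle, A) →ₗ[ℂ] A where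
  toFun f := ∫ ζ : Circle, (ζ : ℂ) ^ (-n) • f ζ ∂haarCircle
  map_add' f g := by
    simp only [ContinuousMap.add_apply, smul_add]
    exact integral_add (integrable_continuousMap _ f) (integrable_continuousMap _ g)
  map_smul' c f := by
    simp only [ContinuousMap.smul_apply, smul_comm _ c, RingHom.id_apply]
    exact integral_smul c _

theorem norm_fourierCoefficient_le (n : ℤ) (f : C(Circle, A)) :
    ‖fourierCoefficient n f‖ ≤ ‖f‖ := by
  have := norm_integral_le_of_norm_le_const (μ := haarCircle)
    (f := fun ζ : Circle => (ζ : ℂ) ^ (-n) • f ζ) (C := ‖f‖) (.of_forall fun ζ => by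
      rw [norm_smul, norm_zpow_coe, one_mul]
      exact f.norm_coe_le_norm ζ)
  simpa [fourierCoefficient] using this

theorem fourierCoefficient_monomial (m n : ℤ) (a : A) :
    fourierCoefficient m (monomial n a) = if n = m then a else 0 := by
  have : fourierCoefficient m (monomial n a) =
      (∫ ζ : Circle, (ζ : ℂ) ^ (n - m) ∂haarCircle) • a := by
    rw [← integral_smul_const]
    refine integral_congr_ae (.of_forall fun ζ => ?_)
    simp only [monomial_apply, smul_smul]
    rw [← zpow_add₀ (Circle.coe_ne_zero ζ), neg_add_eq_sub]
  rw [this, integral_zpow]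
  simp only [sub_eq_zero, ite_smul, one_smul, zero_smul]

/-- Evaluation of trigonometric polynomials of degree at most `N` at the inverse of a unitary. -/
noncomputable def evalInv (N : ℕ) (v : unitary A) : C(Circle, A) →ₗ[ℂ] A :=
  ∑ n ∈ Finset.Icc (-N : ℤ) N,
    (LinearMap.mulRight ℂ ((v ^ (-n) : unitary A) : A)) ∘ₗ fourierCoefficient n

theorem evalInv_apply (N : ℕ) (v : unitary A) (f : C(Circle, A)) :
    evalInv N v f =
      ∑ n ∈ Finset.Icc (-N : ℤ) N, fourierCoefficient n f * ((v ^ (-n) : unitary A) : A) := by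
  simp [evalInv]

theorem evalInv_monomial {N : ℕ} {n : ℤ} (hn : n ∈ Finset.Icc (-N : ℤ) N) (v : unitary A)
    (a : A) : evalInv N v (monomial n a) = a * ((v ^ (-n) : unitary A) : A) := by
  rw [evalInv_apply, Finset.sum_eq_single_of_mem n hn]
  · simp [fourierCoefficient_monomial]
  · intro m _ hm
    rw [fourierCoefficient_monomial, if_neg (Ne.symm hm), zero_mul]

/-- This crude bound is useful because it grows only linearly in the degree: a passage to high
powers removes the factor. -/
theorem norm_evalInv_le (N : ℕ) (v : unitary A) (f : C(Circle, A)) :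
    ‖evalInv N v f‖ ≤ (2 * N + 1) * ‖f‖ := by
  rw [evalInv_apply]
  refine (norm_sum_le_of_le _ fun n _ => (?_ : _ ≤ ‖f‖)).trans (le_of_eq ?_)
  · rw [CStarRing.norm_mul_coe_unitary]
    exact norm_fourierCoefficient_le n f
  · rw [Finset.sum_const, Int.card_Icc, nsmul_eq_mul]
    congr 1
    have : ((N : ℤ) + 1 - -N).toNat = 2 * N + 1 := by omega
    rw [this]
    push_cast
    ring

variable {ι : Type*} {l : Filter ι} {v : ι → unitary A}

/-- A net of unitaries is asymptotically central if it asymptotically commutes with every element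
of the algebra. -/
def IsAsymptoticallyCentral (l : Filter ι) (v : ι → unitary A) : Prop :=
  ∀ a : A, Tendsto (fun i => (v i : A) * a - a * (v i : A)) l (𝓝 0)

theorem IsAsymptoticallyCentral.zpow (hv : IsAsymptoticallyCentral l v) (n : ℤ) :
    IsAsymptoticallyCentral l fun i => v i ^ n := by
  have hmul : ∀ {w w' : ι → unitary A}, IsAsymptoticallyCentral l w →
      IsAsymptoticallyCentral l w' → IsAsymptoticallyCentral l (w * w') := by
    intro w w' hw hw' a
    rw [tendsto_zero_iff_norm_tendsto_zero]
    have h := (tendsto_zero_iff_norm_tendsto_zero.mp (hw a)).add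
      (tendsto_zero_iff_norm_tendsto_zero.mp (hw' a))
    rw [add_zero] at h
    refine squeeze_zero (fun _ => norm_nonneg _) (fun i => ?_) h
    have e : ((w * w') i : A) * a - a * ((w * w') i : A) =
        ((w i : A) * a - a * (w i : A)) * (w' i : A) +
          (w i : A) * ((w' i : A) * a - a * (w' i : A)) := by
      simp only [Pi.mul_apply, Submonoid.coe_mul]
      noncomm_ring
    rw [e]
    refine (norm_add_le _ _).trans ?_
    rw [CStarRing.norm_mul_coe_unitary, CStarRing.norm_coe_unitary_mul]
  have hinv : ∀ {w : ι → unitary A}, IsAsymptoticallyCentral l w →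
      IsAsymptoticallyCentral l w⁻¹ := by
    intro w hw a
    rw [tendsto_zero_iff_norm_tendsto_zero]
    refine (tendsto_zero_iff_norm_tendsto_zero.mp (hw a)).congr fun i => ?_
    have e1 : (w i : A) * (((w⁻¹) i : unitary A) : A) = 1 := by
      rw [← Submonoid.coe_mul]; simp
    have e2 : (((w⁻¹) i : unitary A) : A) * (w i : A) = 1 := by
      rw [← Submonoid.coe_mul]; simp
    have e3 : (w i : A) * (((w⁻¹) i : A) * a - a * ((w⁻¹) i : A)) * (w i : A) =
        a * (w i : A) - (w i : A) * a := by
      rw [mul_sub, sub_mul, ← mul_assoc, e1, one_mul, mul_assoc, mul_assoc, e2, mul_one]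
    rw [norm_sub_rev, ← e3, CStarRing.norm_mul_coe_unitary, CStarRing.norm_coe_unitary_mul]
  have hone : IsAsymptoticallyCentral l (1 : ι → unitary A) := fun a => by simp [tendsto_const_nhds]
  have hpow : ∀ n : ℕ, IsAsymptoticallyCentral l (v ^ n) := by
    intro n
    induction n with
    | zero => simpa using hone
    | succ n ih => rw [pow_succ]; exact hmul ih hv
  cases n with
  | ofNat n => simpa [Pi.pow_def] using hpow n
  | negSucc n =>
    simp only [zpow_negSucc]
    exact hinv (hpow (n + 1))

/-- Along an asymptotically central net, evaluation is asymptotically multiplicative. -/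
theorem IsAsymptoticallyCentral.tendsto_evalInv_mul (hv : IsAsymptoticallyCentral l v)
    {M N : ℕ} {f g : C(Circle, A)} (hf : f ∈ trigPolynomialsOfDegree A M)
    (hg : g ∈ trigPolynomialsOfDegree A N) :
    f * g ∈ trigPolynomialsOfDegree A (M + N) ∧
      Tendsto (fun i => evalInv (M + N) (v i) (f * g) - evalInv M (v i) f * evalInv N (v i) g)
        l (𝓝 0) := by
  induction hf using Submodule.span_induction with
  | zero => simp [tendsto_const_nhds]
  | add f f' _ _ ih ih' =>
    refine ⟨by rw [add_mul]; exact add_mem ih.1 ih'.1, ?_⟩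
    have := ih.2.add ih'.2
    rw [add_zero] at this
    refine this.congr fun i => ?_
    simp only [add_mul, map_add]; abel
  | smul c f _ ih =>
    refine ⟨by rw [smul_mul_assoc]; exact Submodule.smul_mem _ _ ih.1, ?_⟩
    have := ih.2.const_smul c
    rw [smul_zero] at this
    refine this.congr fun i => ?_
    simp only [smul_mul_assoc, map_smul, smul_sub]
  | mem f hf =>
    obtain ⟨m, a, hm, rfl⟩ := hf
    induction hg using Submodule.span_induction with
    | zero => simp [tendsto_const_nhds]
    | add f f' _ _ ih ih' =>
      refine ⟨by rw [mul_add]; exact add_mem ih.1 ih'.1, ?_⟩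
      have := ih.2.add ih'.2
      rw [add_zero] at this
      refine this.congr fun i => ?_
      simp only [mul_add, map_add]; abel
    | smul c f _ ih =>
      refine ⟨by rw [mul_smul_comm]; exact Submodule.smul_mem _ _ ih.1, ?_⟩
      have := ih.2.const_smul c
      rw [smul_zero] at this
      refine this.congr fun i => ?_
      simp only [mul_smul_comm, map_smul, smul_sub]
    | mem f hf =>
      obtain ⟨n, b, hn, rfl⟩ := hf
      have hmn : m + n ∈ Finset.Icc (-(M + N : ℕ) : ℤ) (M + N : ℕ) := by
        rw [Finset.mem_Icc] at hm hn ⊢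
        push_cast
        omega
      rw [monomial_mul]
      refine ⟨monomial_mem_trigPolynomialsOfDegree hmn _, ?_⟩
      have := (tendsto_zero_iff_norm_tendsto_zero.mp (hv.zpow (-m) b)).const_mul ‖a‖
      rw [mul_zero] at this
      refine squeeze_zero_norm (fun i => ?_) this
      rw [evalInv_monomial hmn, evalInv_monomial hm, evalInv_monomial hn]
      have e : a * b * ((v i ^ (-(m + n)) : unitary A) : A) -
          a * ((v i ^ (-m) : unitary A) : A) * (b * ((v i ^ (-n) : unitary A) : A)) =
          -(a * ((((v i ^ (-m) : unitary A) : A) * b - b * ((v i ^ (-m) : unitary A) : A)) *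
            ((v i ^ (-n) : unitary A) : A))) := by
        rw [neg_add, zpow_add, Submonoid.coe_mul]
        noncomm_ring
      rw [e, norm_neg]
      refine (norm_mul_le _ _).trans ?_
      rw [CStarRing.norm_mul_coe_unitary]

/-- On a monomial the two sides are `star a * v^n` and `v^n * star a`, so they differ by a
commutator that tends to `0`. -/
theorem IsAsymptoticallyCentral.tendsto_evalInv_star (hv : IsAsymptoticallyCentral l v)
    {N : ℕ} {f : C(Circle, A)} (hf : f ∈ trigPolynomialsOfDegree A N) :
    star f ∈ trigPolynomialsOfDegree A N ∧
      Tendsto (fun i => evalInv N (v i) (star f) - star (evalInv N (v i) f)) l (𝓝 0) := by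
  induction hf using Submodule.span_induction with
  | zero => simp [tendsto_const_nhds]
  | add f f' _ _ ih ih' =>
    refine ⟨by rw [star_add]; exact add_mem ih.1 ih'.1, ?_⟩
    have := ih.2.add ih'.2
    rw [add_zero] at this
    refine this.congr fun i => ?_
    simp only [star_add, map_add]; abel
  | smul c f _ ih =>
    refine ⟨by rw [star_smul]; exact Submodule.smul_mem _ _ ih.1, ?_⟩
    have := ih.2.const_smul (star c)
    rw [smul_zero] at this
    refine this.congr fun i => ?_
    simp only [star_smul, map_smul, smul_sub]
  | mem f hf =>
    obtain ⟨n, a, hn, rfl⟩ := hf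
    have hn' : -n ∈ Finset.Icc (-N : ℤ) N := by
      rw [Finset.mem_Icc] at hn ⊢
      omega
    rw [star_monomial]
    refine ⟨monomial_mem_trigPolynomialsOfDegree hn' _, ?_⟩
    have := (hv.zpow n (star a)).neg
    rw [neg_zero] at this
    refine this.congr fun i => ?_
    rw [evalInv_monomial hn', evalInv_monomial hn, star_mul, ← Unitary.coe_star,
      Unitary.star_eq_inv, ← zpow_neg, neg_neg]
    abel

/-- Along an asymptotically central net, evaluation is asymptotically contractive. -/
theorem IsAsymptoticallyCentral.eventually_norm_evalInv_lt (hv : IsAsymptoticallyCentral l v)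
    {N : ℕ} {f : C(Circle, A)} (hf : f ∈ trigPolynomialsOfDegree A N) {r : ℝ} (hr : ‖f‖ < r) :
    ∀ᶠ i in l, ‖evalInv N (v i) f‖ < r := by
  have hr0 : 0 < r := (norm_nonneg f).trans_lt hr
  set g := star f * f with hg
  -- Repeated squaring, as in the spectral radius formula: the power `g ^ 2 ^ k` has degree at most
  -- `2 ^ (k + 1) * N`, and evaluation nearly commutes with taking it.
  have hsq : ∀ k : ℕ, g ^ 2 ^ k ∈ trigPolynomialsOfDegree A (2 ^ (k + 1) * N) ∧
      Tendsto (fun i => evalInv (2 ^ (k + 1) * N) (v i) (g ^ 2 ^ k) -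
        (star (evalInv N (v i) f) * evalInv N (v i) f) ^ 2 ^ k) l (𝓝 0) := by
    have hbdd : ∀ i, ‖evalInv N (v i) f‖ ≤ (2 * N + 1) * ‖f‖ := fun i => norm_evalInv_le N _ f
    intro k
    induction k with
    | zero =>
      obtain ⟨h1, h2⟩ := hv.tendsto_evalInv_star hf
      obtain ⟨h3, h4⟩ := hv.tendsto_evalInv_mul h1 hf
      have hN : 2 ^ (0 + 1) * N = N + N := by ring
      simp only [pow_zero, pow_one]
      rw [hN]
      refine ⟨h3, ?_⟩
      have h5 : Tendsto (fun i => (evalInv N (v i) (star f) - star (evalInv N (v i) f)) *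
          evalInv N (v i) f) l (𝓝 0) := by
        refine squeeze_zero_norm (fun i => norm_mul_le_of_le le_rfl (hbdd i)) ?_
        simpa using (tendsto_zero_iff_norm_tendsto_zero.mp h2).mul_const ((2 * N + 1) * ‖f‖)
      have := h4.add h5
      rw [add_zero] at this
      refine this.congr fun i => ?_
      rw [hg]
      noncomm_ring
    | succ k ih =>
      obtain ⟨h1, h2⟩ := ih
      obtain ⟨h3, h4⟩ := hv.tendsto_evalInv_mul h1 h1
      have hN : 2 ^ (k + 1 + 1) * N = 2 ^ (k + 1) * N + 2 ^ (k + 1) * N := by ring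
      have hp : ∀ {R : Type u} [Monoid R] (x : R), x ^ 2 ^ (k + 1) = x ^ 2 ^ k * x ^ 2 ^ k := by
        intro R _ x
        rw [← pow_add]; congr 1; ring
      rw [hN, hp g]
      refine ⟨h3, ?_⟩
      set F := fun i => evalInv (2 ^ (k + 1) * N) (v i) (g ^ 2 ^ k) with hF
      set G := fun i => (star (evalInv N (v i) f) * evalInv N (v i) f) ^ 2 ^ k with hG
      have hFb : ∀ i, ‖F i‖ ≤ (2 * (2 ^ (k + 1) * N : ℕ) + 1) * ‖g ^ 2 ^ k‖ := fun i =>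
        norm_evalInv_le _ _ _
      set C := (2 * (2 ^ (k + 1) * N : ℕ) + 1) * ‖g ^ 2 ^ k‖ with hC
      have h2' := tendsto_zero_iff_norm_tendsto_zero.mp h2
      have h5 : Tendsto (fun i => F i * (F i - G i)) l (𝓝 0) := by
        refine squeeze_zero_norm (fun i => norm_mul_le_of_le (hFb i) le_rfl) ?_
        simpa using h2'.const_mul C
      have h6 : Tendsto (fun i => (F i - G i) * F i) l (𝓝 0) := by
        refine squeeze_zero_norm (fun i => norm_mul_le_of_le le_rfl (hFb i)) ?_
        simpa using h2'.mul_const C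
      have h7 : Tendsto (fun i => (F i - G i) * (F i - G i)) l (𝓝 0) := by
        simpa using h2.mul h2
      have := ((h4.add h5).add h6).sub h7
      simp only [add_zero, sub_zero] at this
      refine this.congr fun i => ?_
      rw [hp (star (evalInv N (v i) f) * evalInv N (v i) f)]
      simp only [hF, hG]
      noncomm_ring
  -- Since `‖f‖ < r`, exponential decay beats the linear factor of `norm_evalInv_le`. A single `k`
  -- is then fixed before the limit along the net is used.
  have hlim : Tendsto (fun k : ℕ => (2 * (2 ^ (k + 1) * N : ℕ) + 1 : ℝ) *
      (‖f‖ / r) ^ (2 ^ (k + 1))) atTop (𝓝 0) := by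
    have hq0 : 0 ≤ ‖f‖ / r := by positivity
    have hq1 : ‖f‖ / r < 1 := (div_lt_one hr0).mpr hr
    have h1 := (tendsto_self_mul_const_pow_of_lt_one hq0 hq1).const_mul (2 * N : ℝ)
    have h2 := h1.add (tendsto_pow_atTop_nhds_zero_of_lt_one hq0 hq1)
    rw [mul_zero, add_zero] at h2
    have h3 : Tendsto (fun k : ℕ => 2 ^ (k + 1)) atTop (atTop : Filter ℕ) :=
      (tendsto_pow_atTop_atTop_of_one_lt one_lt_two).comp (tendsto_add_atTop_nat 1)
    refine (h2.comp h3).congr fun k => ?_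
    simp only [Function.comp_apply]
    push_cast
    ring
  obtain ⟨k, hk⟩ := (hlim.eventually (gt_mem_nhds (half_pos one_pos))).exists
  obtain ⟨-, h⟩ := hsq k
  have hrp : 0 < r ^ 2 ^ (k + 1) := by positivity
  filter_upwards [(tendsto_zero_iff_norm_tendsto_zero.mp h).eventually
    (gt_mem_nhds (half_pos hrp))] with i hi
  set x := evalInv N (v i) f with hx
  -- The C⋆-identity makes norms of powers of self-adjoint elements exact, so the estimate on powers
  -- descends to `x`.
  have hxpow : ‖(star x * x) ^ 2 ^ k‖ = ‖x‖ ^ 2 ^ (k + 1) := by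
    have h1 := (IsSelfAdjoint.star_mul_self x).nnnorm_pow_two_pow k
    have h2 : ‖(star x * x) ^ 2 ^ k‖ = ‖star x * x‖ ^ 2 ^ k := congrArg NNReal.toReal h1
    rw [h2, CStarRing.norm_star_mul_self, ← pow_two, ← pow_mul]
    congr 1; ring
  have hgpow : ‖g ^ 2 ^ k‖ ≤ ‖f‖ ^ 2 ^ (k + 1) := by
    have h1 := (IsSelfAdjoint.star_mul_self f).nnnorm_pow_two_pow k
    have h2 : ‖g ^ 2 ^ k‖ = ‖star f * f‖ ^ 2 ^ k := congrArg NNReal.toReal h1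
    rw [h2, CStarRing.norm_star_mul_self, ← pow_two, ← pow_mul]
    apply le_of_eq
    congr 1; ring
  refine lt_of_pow_lt_pow_left₀ (2 ^ (k + 1)) hr0.le ?_
  rw [← hxpow]
  have hb := norm_evalInv_le (2 ^ (k + 1) * N) (v i) (g ^ 2 ^ k)
  have hk' : (2 * (2 ^ (k + 1) * N : ℕ) + 1 : ℝ) * ‖f‖ ^ (2 ^ (k + 1)) <
      1 / 2 * r ^ 2 ^ (k + 1) := by
    rw [div_pow, ← mul_div_assoc, div_lt_iff₀ hrp] at hk
    exact hk
  have hb' : ‖evalInv (2 ^ (k + 1) * N) (v i) (g ^ 2 ^ k)‖ ≤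
      (2 * (2 ^ (k + 1) * N : ℕ) + 1 : ℝ) * ‖f‖ ^ (2 ^ (k + 1)) := hb.trans (by gcongr)
  have := norm_sub_norm_le ((star x * x) ^ 2 ^ k) (evalInv (2 ^ (k + 1) * N) (v i) (g ^ 2 ^ k))
  rw [norm_sub_rev] at hi
  linarith

end TrigPolynomials

end CircleAction

/-! ### Pure infiniteness of the fixed point algebra -/

theorem isPurelyInfiniteSimple_of_forall {B : Type*} [NonUnitalCStarAlgebra B] [Nontrivial B]
    (h : ∀ a b : B, a ≠ 0 → ∃ x y : B, x * a * y = b) : IsPurelyInfiniteSimple B := by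
  refine ⟨⟨inferInstance, fun I _ => ?_⟩, h⟩
  by_cases hI : ∃ a ∈ I, a ≠ 0
  · obtain ⟨a, haI, ha⟩ := hI
    refine Or.inr (eq_top_iff.mpr fun b _ => ?_)
    obtain ⟨x, y, rfl⟩ := h a b ha
    exact I.mul_mem_right _ _ (I.mul_mem_left _ _ haI)
  · push Not at hI
    refine Or.inl (eq_bot_iff.mpr fun b hb => ?_)
    rw [hI b hb]
    exact zero_mem _

namespace CircleAction

open Filter Topology

variable {A : Type u} [CStarAlgebra A] (α : CircleAction A)

/-- The orbit map `ζ ↦ α_ζ(a)` of an element. -/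
noncomputable def orbit (a : A) : C(Circle, A) := ⟨fun ζ => α ζ a, α.continuous_apply a⟩

@[simp]
theorem orbit_apply (a : A) (ζ : Circle) : α.orbit a ζ = α ζ a := rfl

theorem norm_orbit_le (a : A) : ‖α.orbit a‖ ≤ ‖a‖ :=
  (ContinuousMap.norm_le _ (norm_nonneg a)).mpr fun ζ => (α.norm_apply ζ a).le

variable {α} in
theorem orbit_eq_monomial {n : ℤ} {a : A} (ha : a ∈ α.spectralSubspace n) :
    α.orbit a = monomial n a := by
  ext ζ; exact ha ζ

theorem exists_orbit_mem_trigPolynomialsOfDegree {a : A} (ha : a ∈ ⨆ n, α.spectralSubspace n) :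
    ∃ N, α.orbit a ∈ trigPolynomialsOfDegree A N := by
  induction ha using Submodule.iSup_induction' with
  | mem n a ha =>
    refine ⟨n.natAbs, ?_⟩
    rw [orbit_eq_monomial ha]
    refine monomial_mem_trigPolynomialsOfDegree ?_ a
    rw [Finset.mem_Icc]; omega
  | zero =>
    refine ⟨0, ?_⟩
    have : α.orbit 0 = 0 := by ext ζ; simp
    rw [this]; exact zero_mem _
  | add a b _ _ iha ihb =>
    obtain ⟨M, hM⟩ := iha
    obtain ⟨N, hN⟩ := ihb
    refine ⟨max M N, ?_⟩
    have : α.orbit (a + b) = α.orbit a + α.orbit b := by ext ζ; simp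
    rw [this]
    exact add_mem (trigPolynomialsOfDegree_mono (le_max_left _ _) hM)
      (trigPolynomialsOfDegree_mono (le_max_right _ _) hN)

variable {α} in
-- The `n`-th Fourier coefficient of an orbit has degree `n` and `v^(-n)` has degree `-n`, so every
-- summand has degree `0`.
theorem evalInv_orbit_mem_fixedPoints {v : unitary A} (hv : v ∈ α.eigenunitaries) (N : ℕ)
    (a : A) : evalInv N v (α.orbit a) ∈ α.fixedPoints := by
  rw [← mem_spectralSubspace_zero, evalInv_apply]
  refine Submodule.sum_mem _ fun n _ => ?_
  have h1 : fourierCoefficient n (α.orbit a) ∈ α.spectralSubspace n := by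
    have := α.integral_mem_spectralSubspace (-n) a
    rwa [neg_neg] at this
  have := mul_mem_spectralSubspace h1 (zpow_mem_spectralSubspace hv (-n))
  rwa [add_neg_cancel] at this

variable {α} in
/-- Under the Rokhlin property there is an asymptotically central net of eigenunitaries. -/
theorem HasRokhlinProperty.exists_isAsymptoticallyCentral [Nontrivial A]
    (hα : α.HasRokhlinProperty) :
    ∃ v : Finset A × ℕ → unitary A, (∀ i, v i ∈ α.eigenunitaries) ∧
      IsAsymptoticallyCentral atTop v := by
  classical
  choose v hv hvF using fun i : Finset A × ℕ =>
    hα.exists_eigenunitary (Nat.one_div_pos_of_nat (α := ℝ) (n := i.2)) i.1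
  refine ⟨v, hv, fun a => ?_⟩
  rw [Metric.tendsto_atTop]
  intro ε hε
  obtain ⟨k, hk⟩ := exists_nat_one_div_lt hε
  refine ⟨({a}, k), fun i hi => ?_⟩
  rw [dist_zero_right]
  refine (hvF i a (hi.1 (Finset.mem_singleton_self a))).trans (lt_of_le_of_lt ?_ hk)
  exact Nat.one_div_le_one_div hi.2

variable {α} in
/-- Nonzero elements of the fixed point algebra can be cut down to the unit. -/
theorem HasRokhlinProperty.exists_mul_mul_eq_one (hA : IsPurelyInfiniteSimple A)
    (hα : α.HasRokhlinProperty) (a : α.fixedPoints) (ha : a ≠ 0) :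
    ∃ x y : α.fixedPoints, x * a * y = 1 := by
  classical
  have : Nontrivial A := hA.1.1
  have ha' : (a : A) ≠ 0 := fun h => ha (Subtype.ext h)
  obtain ⟨x, y, hxy⟩ := hA.2 (a : A) 1 ha'
  -- Evaluation is controlled only on trigonometric polynomials, so `x` and `y` are replaced by
  -- elements whose orbits are such polynomials.
  obtain ⟨x', hx', y', hy', hlt⟩ : ∃ x' ∈ ⨆ n, α.spectralSubspace n,
      ∃ y' ∈ ⨆ n, α.spectralSubspace n, ‖x' * a * y' - 1‖ < 1 / 2 := by
    have hD := α.dense_iSup_spectralSubspace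
    have hc : Continuous fun p : A × A => ‖p.1 * a * p.2 - 1‖ := by fun_prop
    have hopen : IsOpen {p : A × A | ‖p.1 * a * p.2 - 1‖ < 1 / 2} := isOpen_lt hc continuous_const
    obtain ⟨p, hp, hpD⟩ := (hD.prod hD).inter_open_nonempty _ hopen
      ⟨(x, y), by simp [hxy]⟩
    exact ⟨p.1, hpD.1, p.2, hpD.2, hp⟩
  obtain ⟨M, hM⟩ := α.exists_orbit_mem_trigPolynomialsOfDegree hx'
  obtain ⟨N, hN⟩ := α.exists_orbit_mem_trigPolynomialsOfDegree hy'
  obtain ⟨v, hv, hvc⟩ := hα.exists_isAsymptoticallyCentral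
  have ha0 : (a : A) ∈ α.spectralSubspace 0 := α.mem_spectralSubspace_zero.mpr a.2
  have h0 : ∀ K : ℕ, (0 : ℤ) ∈ Finset.Icc (-K : ℤ) K := fun K => by
    rw [Finset.mem_Icc]; omega
  have haT : α.orbit (a : A) ∈ trigPolynomialsOfDegree A 0 := by
    rw [orbit_eq_monomial ha0]
    exact monomial_mem_trigPolynomialsOfDegree (h0 0) _
  obtain ⟨h1, h2⟩ := hvc.tendsto_evalInv_mul hM haT
  obtain ⟨h3, h4⟩ := hvc.tendsto_evalInv_mul h1 hN
  set K := M + 0 + N with hK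
  set f := α.orbit x' * α.orbit (a : A) * α.orbit y' - α.orbit 1 with hf
  have h1e : α.orbit 1 = monomial 0 1 := orbit_eq_monomial α.one_mem_spectralSubspace
  have hfT : f ∈ trigPolynomialsOfDegree A K := by
    refine sub_mem h3 ?_
    rw [h1e]
    exact monomial_mem_trigPolynomialsOfDegree (h0 K) _
  have hfe : f = α.orbit (x' * a * y' - 1) := by
    ext ζ; simp [hf]
  have hfn : ‖f‖ < 1 / 2 := by rw [hfe]; exact (α.norm_orbit_le _).trans_lt hlt
  have hev := hvc.eventually_norm_evalInv_lt hfT hfn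
  -- Evaluation fixes `a` and `1`, so the image of `f` is asymptotically `X * a * Y - 1` with `X`,
  -- `Y` in the fixed point algebra. The two errors below `1 / 2` add up to less than `1`.
  have hdiff : Tendsto (fun i => evalInv K (v i) f -
      (evalInv M (v i) (α.orbit x') * a * evalInv N (v i) (α.orbit y') - 1)) atTop (𝓝 0) := by
    have h5 : Tendsto (fun i => (evalInv (M + 0) (v i) (α.orbit x' * α.orbit (a : A)) -
        evalInv M (v i) (α.orbit x') * evalInv 0 (v i) (α.orbit (a : A))) *
        evalInv N (v i) (α.orbit y')) atTop (𝓝 0) := by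
      refine squeeze_zero_norm (fun i => norm_mul_le_of_le le_rfl (norm_evalInv_le N _ _)) ?_
      simpa using (tendsto_zero_iff_norm_tendsto_zero.mp h2).mul_const
        ((2 * N + 1) * ‖α.orbit y'‖)
    have h6 := h4.add h5
    rw [add_zero (0 : A)] at h6
    refine h6.congr fun i => ?_
    have e1 : evalInv 0 (v i) (α.orbit (a : A)) = a := by
      rw [orbit_eq_monomial ha0, evalInv_monomial (h0 0)]; simp
    have e2 : evalInv K (v i) (α.orbit 1) = 1 := by
      rw [h1e, evalInv_monomial (h0 K)]; simp
    rw [hf, map_sub, e1, e2]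
    noncomm_ring
  obtain ⟨i, hi1, hi2⟩ := (hev.and ((tendsto_zero_iff_norm_tendsto_zero.mp hdiff).eventually
    (gt_mem_nhds (half_pos one_pos)))).exists
  let X : α.fixedPoints := ⟨_, evalInv_orbit_mem_fixedPoints (hv i) M x'⟩
  let Y : α.fixedPoints := ⟨_, evalInv_orbit_mem_fixedPoints (hv i) N y'⟩
  have hlt1 : ‖1 - X * a * Y‖ < 1 := by
    have h7 : ‖evalInv M (v i) (α.orbit x') * a * evalInv N (v i) (α.orbit y') - 1‖ < 1 := by
      have := norm_sub_norm_le
        (evalInv M (v i) (α.orbit x') * a * evalInv N (v i) (α.orbit y') - 1)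
        (evalInv K (v i) f)
      rw [norm_sub_rev] at hi2
      linarith
    rw [norm_sub_rev]
    exact h7
  have hu : IsUnit (X * a * Y) := by simpa using isUnit_one_sub_of_norm_lt_one hlt1
  obtain ⟨z, hz⟩ := hu
  refine ⟨(↑z⁻¹ : α.fixedPoints) * X, Y, ?_⟩
  rw [mul_assoc, mul_assoc, ← mul_assoc X, ← hz, Units.inv_mul]

variable {α} in
theorem HasRokhlinProperty.isPurelyInfiniteSimple_fixedPoints (hA : IsPurelyInfiniteSimple A)
    (hα : α.HasRokhlinProperty) : IsPurelyInfiniteSimple α.fixedPoints := by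
  have : Nontrivial A := hA.1.1
  refine isPurelyInfiniteSimple_of_forall fun a b ha => ?_
  obtain ⟨x, y, hxy⟩ := hα.exists_mul_mul_eq_one hA a ha
  exact ⟨x, y * b, by rw [← mul_assoc, hxy, one_mul]⟩

end CircleAction

/-! ### Isometries with orthogonal ranges -/

section Isometries

variable {D : Type*} [CStarAlgebra D]

/-- A left invertible element of the form `e * y` can be corrected to an isometry. -/
theorem exists_isometry_of_mul_mul_eq_one {x e y : D} (h : x * e * y = 1) :
    ∃ t : D, star (e * t) * (e * t) = 1 := by
  let _ := CStarAlgebra.spectralOrder D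
  have := CStarAlgebra.spectralOrderedRing D
  set k := star (e * y) * (e * y) with hk
  have hk0 : 0 ≤ k := star_mul_self_nonneg _
  -- Conjugating `star x * x ≤ ‖star x * x‖` by `e * y` bounds `k` from below. Thus `k` is
  -- invertible, and `t = y * k^(-1/2)` normalizes `e * y`.
  have hle : (1 : D) ≤ ‖star x * x‖ • k := by
    have h1 : star (e * y) * (star x * x) * (e * y) = 1 := by
      have : star (e * y) * (star x * x) * (e * y) = star (x * e * y) * (x * e * y) := by
        simp only [star_mul, mul_assoc]
      rw [this, h, star_one, one_mul]
    rw [← h1]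
    exact CStarAlgebra.star_left_conjugate_le_norm_smul
  have hunit : IsUnit k := by
    have h2 : IsUnit (‖star x * x‖ • k) := CStarAlgebra.isUnit_of_le (1 : D) hle
    by_cases hx : ‖star x * x‖ = 0
    · rw [hx, zero_smul] at h2
      have : Subsingleton D := isUnit_zero_iff.mp h2 |> fun h => subsingleton_of_zero_eq_one h
      exact isUnit_of_subsingleton k
    · exact (isUnit_smul_iff (Units.mk0 _ hx) k).mp h2
  set r := k ^ (-(1 / 2) : ℝ) with hr_def
  have hr : star r = r := (IsSelfAdjoint.of_nonneg CFC.rpow_nonneg).star_eq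
  refine ⟨y * r, ?_⟩
  have e1 : star (e * (y * r)) * (e * (y * r)) = r * k * r := by
    rw [← mul_assoc e, star_mul (e * y), hr, hk]
    simp only [mul_assoc]
  rw [e1]
  have hk1 : r * k ^ (1 : ℝ) * r = 1 := by
    rw [hr_def, ← CFC.rpow_add hunit, ← CFC.rpow_add hunit]
    norm_num
    exact CFC.rpow_zero k
  rwa [CFC.rpow_one k] at hk1

/-- A unital C⋆-algebra contains two nonzero orthogonal elements unless all of its elements are
scalar. -/
theorem exists_orthogonal_or_forall_scalar [Nontrivial D] :
    (∃ e d : D, e ≠ 0 ∧ d ≠ 0 ∧ star e * d = 0) ∨ ∀ a : D, ∃ c : ℂ, a = algebraMap ℂ D c := by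
  by_cases H : ∃ h : D, IsSelfAdjoint h ∧ ∃ x ∈ spectrum ℝ h, ∃ y ∈ spectrum ℝ h, x < y
  · left
    obtain ⟨h, hh, x, hx, y, hy, hxy⟩ := H
    -- The positive and negative parts of `h - m` are orthogonal, and both are nonzero because the
    -- spectrum meets both sides of `m`.
    set m := (x + y) / 2 with hm
    have hne : ∀ f : ℝ → ℝ, Continuous f → ∀ z ∈ spectrum ℝ h, f z ≠ 0 → cfc f h ≠ 0 := by
      intro f hf z hz hfz h0
      have h1 := cfc_map_spectrum f h hh hf.continuousOn
      rw [h0, spectrum.zero_eq] at h1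
      have : f z ∈ ({0} : Set ℝ) := h1 ▸ Set.mem_image_of_mem f hz
      exact hfz this
    refine ⟨cfc (fun t : ℝ => max 0 (t - m)) h, cfc (fun t : ℝ => max 0 (m - t)) h,
      hne _ (by fun_prop) y hy ?_, hne _ (by fun_prop) x hx ?_, ?_⟩
    · rw [max_eq_right (by linarith)]; linarith
    · rw [max_eq_right (by linarith)]; linarith
    · have : star (cfc (fun t : ℝ => max 0 (t - m)) h) = cfc (fun t : ℝ => max 0 (t - m)) h :=
        cfc_predicate (R := ℝ) (p := IsSelfAdjoint) _ h
      rw [this, ← cfc_mul _ _ h (by fun_prop) (by fun_prop), ← cfc_zero ℝ h]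
      refine cfc_congr fun t _ => ?_
      simp only [Pi.zero_apply]
      rcases le_total t m with ht | ht
      · rw [max_eq_left (by linarith), zero_mul]
      · rw [max_eq_left (b := m - t) (by linarith), mul_zero]
  · right
    push Not at H
    -- Now every self-adjoint element has one-point spectrum, hence is scalar; real and imaginary
    -- parts give the rest.
    have hsa : ∀ h : D, IsSelfAdjoint h → ∃ c : ℂ, h = algebraMap ℂ D c := by
      intro h hh
      obtain ⟨x, hx⟩ := ContinuousFunctionalCalculus.spectrum_nonempty (R := ℝ) h hh
      have hc : h = cfc (fun _ : ℝ => x) h := by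
        nth_rewrite 1 [← cfc_id' ℝ h]
        exact cfc_congr fun y hy => le_antisymm (H h hh x hx y hy) (H h hh y hy x hx)
      rw [cfc_const x h] at hc
      refine ⟨x, hc.trans ?_⟩
      rw [Algebra.algebraMap_eq_smul_one, Algebra.algebraMap_eq_smul_one, Complex.coe_smul]
    intro a
    obtain ⟨c, hc⟩ := hsa _ (realPart a).2
    obtain ⟨d, hd⟩ := hsa _ (imaginaryPart a).2
    refine ⟨c + Complex.I * d, ?_⟩
    rw [map_add, map_mul, ← hc, ← hd]
    nth_rewrite 1 [← realPart_add_I_smul_imaginaryPart a]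
    rw [Algebra.smul_def]

/-- In a purely infinite algebra with two nonzero orthogonal elements there is a sequence of
isometries with pairwise orthogonal ranges. -/
theorem exists_orthogonal_isometries (hD : ∀ a : D, a ≠ 0 → ∃ x y : D, x * a * y = 1)
    {e d : D} (he : e ≠ 0) (hd : d ≠ 0) (hed : star e * d = 0) :
    ∃ s : ℕ → D, ∀ k l, star (s k) * s l = if k = l then 1 else 0 := by
  obtain ⟨x, y, hxy⟩ := hD e he
  obtain ⟨t, ht⟩ := exists_isometry_of_mul_mul_eq_one hxy
  obtain ⟨x', y', hxy'⟩ := hD d hd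
  obtain ⟨t', ht'⟩ := exists_isometry_of_mul_mul_eq_one hxy'
  set a := e * t with ha
  set b := d * t' with hb
  have hab : star a * b = 0 := by
    have : star a * b = star t * (star e * d) * t' := by
      simp only [ha, hb, star_mul, mul_assoc]
    rw [this, hed, mul_zero, zero_mul]
  have hba : star b * a = 0 := by
    have := congrArg star hab
    simpa using this
  have hpow : ∀ k, star (a ^ k) * a ^ k = 1 := by
    intro k
    induction k with
    | zero => simp
    | succ k ih =>
      rw [pow_succ', star_mul, mul_assoc, ← mul_assoc (star a), ht, one_mul, ih]
  have hlt : ∀ k m, star (a ^ k * b) * (a ^ (k + (m + 1)) * b) = 0 := by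
    intro k m
    rw [pow_add, star_mul, mul_assoc, mul_assoc (a ^ k), ← mul_assoc (star (a ^ k)), hpow, one_mul,
      pow_succ', mul_assoc, ← mul_assoc, hba, zero_mul]
  -- The ranges of the isometries `a` and `b` are orthogonal, so the range of `b` is orthogonal to
  -- that of every positive power of `a`.
  refine ⟨fun k => a ^ k * b, fun k l => ?_⟩
  rcases lt_trichotomy k l with h | rfl | h
  · obtain ⟨m, rfl⟩ := Nat.exists_eq_add_of_lt h
    rw [if_neg h.ne]
    exact hlt k m
  · rw [if_pos rfl, star_mul, mul_assoc, ← mul_assoc (star (a ^ k)), hpow, one_mul, ht']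
  · obtain ⟨m, rfl⟩ := Nat.exists_eq_add_of_lt h
    rw [if_neg h.ne']
    have := congrArg star (hlt l m)
    simpa [add_assoc] using this

end Isometries

/-! ### Isometries in the fixed point algebra -/

namespace CircleAction

variable {A : Type u} [CStarAlgebra A] {α : CircleAction A}

/-- Under the Rokhlin property the fixed point algebra does not consist of scalars. -/
theorem HasRokhlinProperty.not_forall_scalar (hA : IsPurelyInfiniteSimple A)
    (hα : α.HasRokhlinProperty) :
    ¬ ∀ a : α.fixedPoints, ∃ c : ℂ, a = algebraMap ℂ α.fixedPoints c := by
  intro H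
  have : Nontrivial A := hA.1.1
  obtain ⟨u, hu, -⟩ := hα.exists_eigenunitary one_pos ∅
  -- If the fixed points were scalars, the spectral subspace of degree `n` would be spanned by
  -- `u^n`, so `u` would be central.
  have hcomm : ∀ a : A, a * u = u * a := by
    have hcl : IsClosed {a : A | a * u = u * a} :=
      isClosed_eq (by fun_prop) (by fun_prop)
    have hsub : (⨆ n, α.spectralSubspace n) ≤
        LinearMap.ker (LinearMap.mulRight ℂ (u : A) - LinearMap.mulLeft ℂ (u : A)) := by
      refine iSup_le fun n a ha => ?_
      have h1 : a * ((u ^ (-n) : unitary A) : A) ∈ α.fixedPoints := by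
        rw [← mem_spectralSubspace_zero]
        have := mul_mem_spectralSubspace ha (zpow_mem_spectralSubspace hu (-n))
        rwa [add_neg_cancel] at this
      obtain ⟨c, hc⟩ := H ⟨_, h1⟩
      have hc' : a * ((u ^ (-n) : unitary A) : A) = algebraMap ℂ A c := congrArg Subtype.val hc
      have hac : a = algebraMap ℂ A c * ((u ^ n : unitary A) : A) := by
        rw [← hc', mul_assoc, ← Submonoid.coe_mul, ← zpow_add, neg_add_cancel, zpow_zero]
        simp
      rw [LinearMap.mem_ker, LinearMap.sub_apply, sub_eq_zero]
      simp only [LinearMap.mulRight_apply, LinearMap.mulLeft_apply]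
      rw [hac, mul_assoc, ← mul_assoc (u : A), ← Algebra.commutes c (u : A), mul_assoc,
        ← Submonoid.coe_mul, ← Submonoid.coe_mul, mul_self_zpow, mul_zpow_self]
    intro a
    refine closure_minimal (fun b hb => ?_) hcl (α.dense_iSup_spectralSubspace a)
    have := hsub hb
    rwa [LinearMap.mem_ker, LinearMap.sub_apply, sub_eq_zero] at this
  obtain ⟨c, hc⟩ := spectrum.nonempty (u : A)
  have hne : algebraMap ℂ A c - u ≠ 0 := by
    intro h0
    have huc : (u : A) = algebraMap ℂ A c := (sub_eq_zero.mp h0).symm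
    -- At `ζ = -1` the eigenvalue equation reads `α_ζ(u) = -u`, whereas scalars are fixed; a scalar
    -- `u` would therefore vanish.
    have h1 := hu (Circle.exp Real.pi)
    rw [huc, Algebra.algebraMap_eq_smul_one, map_smul, map_one] at h1
    simp only [Circle.coe_exp, Complex.exp_pi_mul_I, zpow_one, neg_smul, one_smul] at h1
    have h2 : (u : A) = 0 := by
      rw [huc, Algebra.algebraMap_eq_smul_one]
      have h2 : (2 : ℂ) • c • (1 : A) = 0 := by
        rw [two_smul]
        nth_rewrite 1 [h1]
        exact neg_add_cancel _
      exact (smul_eq_zero.mp h2).resolve_left two_ne_zero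
    have h3 := CStarRing.norm_coe_unitary u
    rw [h2, norm_zero] at h3
    exact zero_ne_one h3
  -- The element `c - u` is central and nonzero, so pure infiniteness makes it invertible, although
  -- `c` lies in the spectrum of `u`.
  obtain ⟨x, y, hxy⟩ := hA.2 _ 1 hne
  have hcomm' : ∀ a, a * (algebraMap ℂ A c - u) = (algebraMap ℂ A c - u) * a := fun a => by
    rw [mul_sub, sub_mul, hcomm, Algebra.commutes]
  refine hc ⟨⟨algebraMap ℂ A c - u, x * y, ?_, ?_⟩, rfl⟩
  · rw [← mul_assoc, ← hcomm', hxy]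
  · rw [mul_assoc, hcomm' y, ← mul_assoc, hxy]

theorem HasRokhlinProperty.exists_orthogonal_isometries_fixedPoints
    (hA : IsPurelyInfiniteSimple A) (hα : α.HasRokhlinProperty) :
    ∃ s : ℕ → α.fixedPoints, ∀ k l, star (s k) * s l = if k = l then 1 else 0 := by
  have : Nontrivial A := hA.1.1
  obtain ⟨e, d, he, hd, hed⟩ :=
    (exists_orthogonal_or_forall_scalar (D := α.fixedPoints)).resolve_right
      (hα.not_forall_scalar hA)
  exact exists_orthogonal_isometries (hα.exists_mul_mul_eq_one hA) he hd hed

end CircleAction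

/-! ### Stabilizations of purely infinite algebras -/

section MatrixUnits

open Filter Topology

variable {I : Type*} [DecidableEq I] {D : Type*} [CStarAlgebra D] {B : Type*}
  [NonUnitalCStarAlgebra B]

/-- Generalized matrix units over the unital C⋆-algebra `D`: linear maps `E i j` from `D` onto the
matrix entries, that multiply like elementary matrices and whose ranges span a dense subspace. -/
structure MatrixSystem (I : Type*) [DecidableEq I] (D : Type*) [CStarAlgebra D] (B : Type*)
    [NonUnitalCStarAlgebra B] where
  entry : I → I → D →ₗ[ℂ] B
  entry_mul_entry : ∀ i j k l a b,
    entry i j a * entry k l b = if j = k then entry i l (a * b) else 0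
  star_entry : ∀ i j a, star (entry i j a) = entry j i (star a)
  dense_span : Dense (Submodule.span ℂ {b | ∃ i j a, entry i j a = b} : Set B)

namespace MatrixSystem

variable (E : MatrixSystem I D B)

/-- The linear span of the matrix entries. -/
def entrySpan : Submodule ℂ B := Submodule.span ℂ {b | ∃ i j a, E.entry i j a = b}

theorem entry_mul_entry_same (i j k : I) (a b : D) :
    E.entry i j a * E.entry j k b = E.entry i k (a * b) := by
  rw [E.entry_mul_entry, if_pos rfl]

theorem entry_mul_entry_of_ne {i j k l : I} (h : j ≠ k) (a b : D) :
    E.entry i j a * E.entry k l b = 0 := by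
  rw [E.entry_mul_entry, if_neg h]

/-- The projection onto finitely many coordinates. -/
noncomputable def proj (F : Finset I) : B := ∑ i ∈ F, E.entry i i 1

theorem star_proj (F : Finset I) : star (E.proj F) = E.proj F := by
  simp [proj, star_sum, E.star_entry]

theorem proj_mul_entry {F : Finset I} {i : I} (hi : i ∈ F) (j : I) (a : D) :
    E.proj F * E.entry i j a = E.entry i j a := by
  rw [proj, Finset.sum_mul, Finset.sum_eq_single_of_mem i hi, entry_mul_entry_same, one_mul]
  intro k _ hk
  exact E.entry_mul_entry_of_ne hk _ _

theorem entry_mul_proj {F : Finset I} {j : I} (hj : j ∈ F) (i : I) (a : D) :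
    E.entry i j a * E.proj F = E.entry i j a := by
  rw [proj, Finset.mul_sum, Finset.sum_eq_single_of_mem j hj, entry_mul_entry_same, mul_one]
  intro k _ hk
  exact E.entry_mul_entry_of_ne hk.symm _ _

theorem norm_proj_le (F : Finset I) : ‖E.proj F‖ ≤ 1 := by
  have h : E.proj F * E.proj F = E.proj F := by
    nth_rewrite 2 [proj]
    rw [Finset.mul_sum]
    exact Finset.sum_congr rfl fun i hi => E.proj_mul_entry hi i 1
  have h2 : ‖E.proj F‖ * ‖E.proj F‖ = ‖E.proj F‖ := by
    rw [← CStarRing.norm_star_mul_self, star_proj, h]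
  nlinarith [norm_nonneg (E.proj F)]

/-- Only finitely many rows and columns occur in `z`. The coordinate projections thus act as an
approximate unit that is eventually exact on the span. -/
theorem exists_proj_mul_eq {z : B} (hz : z ∈ E.entrySpan) :
    ∃ F₀ : Finset I, ∀ F, F₀ ⊆ F → E.proj F * z = z ∧ z * E.proj F = z := by
  induction hz using Submodule.span_induction with
  | mem z hz =>
    obtain ⟨i, j, a, rfl⟩ := hz
    exact ⟨{i, j}, fun F hF => ⟨E.proj_mul_entry (hF (by simp)) j a,
      E.entry_mul_proj (hF (by simp)) i a⟩⟩
  | zero => exact ⟨∅, fun F _ => by simp⟩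
  | add z w _ _ ihz ihw =>
    obtain ⟨F₁, h₁⟩ := ihz
    obtain ⟨F₂, h₂⟩ := ihw
    refine ⟨F₁ ∪ F₂, fun F hF => ?_⟩
    have h₁' := h₁ F (Finset.union_subset_left hF)
    have h₂' := h₂ F (Finset.union_subset_right hF)
    rw [mul_add, add_mul, h₁'.1, h₁'.2, h₂'.1, h₂'.2]
    exact ⟨rfl, rfl⟩
  | smul c z _ ih =>
    obtain ⟨F₁, h₁⟩ := ih
    refine ⟨F₁, fun F hF => ?_⟩
    rw [mul_smul_comm, smul_mul_assoc, (h₁ F hF).1, (h₁ F hF).2]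
    exact ⟨rfl, rfl⟩

/-- A nonzero element has a nonzero matrix entry. -/
theorem exists_entry_ne_zero (o : I) {b : B} (hb : b ≠ 0) :
    ∃ i j, E.entry o i 1 * b * E.entry j o 1 ≠ 0 := by
  by_contra! H
  have hQ : ∀ F, E.proj F * b * E.proj F = 0 := by
    intro F
    rw [proj, Finset.sum_mul, Finset.sum_mul]
    refine Finset.sum_eq_zero fun i _ => ?_
    rw [Finset.mul_sum]
    refine Finset.sum_eq_zero fun j _ => ?_
    have : E.entry i i 1 * b * E.entry j j 1 =
        E.entry i o 1 * (E.entry o i 1 * b * E.entry j o 1) * E.entry o j 1 := by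
      have h1 : E.entry i i 1 = E.entry i o 1 * E.entry o i 1 := by
        rw [entry_mul_entry_same, one_mul]
      have h2 : E.entry j j 1 = E.entry j o 1 * E.entry o j 1 := by
        rw [entry_mul_entry_same, one_mul]
      rw [h1, h2]
      simp only [mul_assoc]
    rw [this, H, mul_zero, zero_mul]
  -- An approximant `z` supported on `F` equals the compression of `z - b`, so `‖z‖ < ‖b‖ / 3` and
  -- `‖b‖ < 2 ‖b‖ / 3`, a contradiction.
  have hpos : 0 < ‖b‖ / 3 := by positivity
  obtain ⟨z, hz, hzb⟩ := Metric.mem_closure_iff.mp (E.dense_span b) _ hpos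
  obtain ⟨F, hF⟩ := E.exists_proj_mul_eq hz
  obtain ⟨h1, h2⟩ := hF F subset_rfl
  have hz' : z = E.proj F * (z - b) * E.proj F := by
    rw [mul_sub, sub_mul, hQ, h1, h2, sub_zero]
  have hzn : ‖z‖ ≤ ‖z - b‖ := by
    nth_rewrite 1 [hz']
    calc _ ≤ ‖E.proj F‖ * ‖z - b‖ * ‖E.proj F‖ := norm_mul₃_le
      _ ≤ 1 * ‖z - b‖ * 1 := by gcongr <;> exact E.norm_proj_le F
      _ = _ := by ring
  rw [dist_eq_norm] at hzb
  have := norm_sub_norm_le b z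
  rw [norm_sub_rev] at hzn
  linarith

/-- The diagonal corner embedding. -/
noncomputable def corner (o : I) : D →⋆ₙₐ[ℂ] B where
  toFun := E.entry o o
  map_smul' := map_smul _
  map_zero' := map_zero _
  map_add' := map_add _
  map_mul' a b := (E.entry_mul_entry_same o o o a b).symm
  map_star' a := (E.star_entry o o a).symm

theorem corner_injective (hD : ∀ a : D, a ≠ 0 → ∃ x y : D, x * a * y = 1) {o : I}
    (ho : E.entry o o 1 ≠ 0) : Function.Injective (E.corner o) := by
  rw [injective_iff_map_eq_zero]
  intro a ha
  by_contra hne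
  obtain ⟨x, y, hxy⟩ := hD a hne
  apply ho
  change E.corner o 1 = 0
  rw [← hxy, map_mul, map_mul, ha, mul_zero, zero_mul]

/-- The corner embedding is injective, hence isometric with closed range. It is therefore enough to
compress the dense span, where a single entry survives. -/
theorem compress_mem_range_corner (hD : ∀ a : D, a ≠ 0 → ∃ x y : D, x * a * y = 1) {o : I}
    (ho : E.entry o o 1 ≠ 0)
    (i j : I) (b : B) :
    E.entry o i 1 * b * E.entry j o 1 ∈ Set.range (E.corner o) := by
  have hiso : Isometry (E.corner o) :=
    AddMonoidHomClass.isometry_of_norm _ fun a =>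
      NonUnitalStarAlgHom.norm_map _ (E.corner_injective hD ho) a
  have hcl : IsClosed (Set.range (E.corner o)) := hiso.isClosedEmbedding.isClosed_range
  have hcont : Continuous fun b : B => E.entry o i 1 * b * E.entry j o 1 := by fun_prop
  suffices key : ∀ z ∈ E.entrySpan, E.entry o i 1 * z * E.entry j o 1 ∈ Set.range (E.corner o) from
    closure_minimal key (hcl.preimage hcont) (E.dense_span b)
  intro z hz
  induction hz using Submodule.span_induction with
  | mem z hz =>
    obtain ⟨k, l, a, rfl⟩ := hz
    by_cases hk : i = k
    · by_cases hl : l = j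
      · subst hk hl
        refine ⟨1 * a * 1, ?_⟩
        rw [entry_mul_entry_same, entry_mul_entry_same]
        rfl
      · exact ⟨0, by rw [map_zero, mul_assoc, E.entry_mul_entry_of_ne hl, mul_zero]⟩
    · exact ⟨0, by rw [map_zero, E.entry_mul_entry_of_ne hk, zero_mul]⟩
  | zero => exact ⟨0, by simp⟩
  | add z w _ _ ihz ihw =>
    obtain ⟨a, ha⟩ := ihz
    obtain ⟨b, hb⟩ := ihw
    exact ⟨a + b, by rw [map_add, ha, hb, mul_add, add_mul]⟩
  | smul c z _ ih =>
    obtain ⟨a, ha⟩ := ih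
    exact ⟨c • a, by rw [map_smul, ha, mul_smul_comm, smul_mul_assoc]⟩

theorem exists_mul_mul_eq_entry (hD : ∀ a : D, a ≠ 0 → ∃ x y : D, x * a * y = 1) {o : I}
    (ho : E.entry o o 1 ≠ 0) {b : B} (hb : b ≠ 0) :
    ∃ x y : B, x * b * y = E.entry o o 1 := by
  obtain ⟨i, j, hij⟩ := E.exists_entry_ne_zero o hb
  obtain ⟨a, ha⟩ := E.compress_mem_range_corner hD ho i j b
  have ha0 : a ≠ 0 := by
    rintro rfl
    exact hij (by rw [← ha, map_zero])
  obtain ⟨x, y, hxy⟩ := hD a ha0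
  refine ⟨E.entry o o x * E.entry o i 1, E.entry j o 1 * E.entry o o y, ?_⟩
  have : E.entry o o x * E.entry o i 1 * b * (E.entry j o 1 * E.entry o o y) =
      E.corner o x * (E.entry o i 1 * b * E.entry j o 1) * E.corner o y := by
    simp only [mul_assoc]; rfl
  rw [this, ← ha, ← map_mul, ← map_mul, hxy]
  rfl

/-- Given isometries with orthogonal ranges in `D`, every element factors through the corner. -/
theorem exists_mul_entry_mul_eq {s : ℕ × I → D}
    (hs : ∀ p q, star (s p) * s q = if p = q then 1 else 0) (o : I) (c : B) :
    ∃ x y : B, x * E.entry o o 1 * y = c := by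
  -- Write `c` as a series of elements `d k` of the algebraic span with norms of order `4^(-k)`.
  obtain ⟨d, hd, hdS, hd0, hdn⟩ := controlled_sum_of_mem_closure
    (s := E.entrySpan.toAddSubgroup) (E.dense_span c) (b := fun k => (1 / 4 : ℝ) ^ k)
    (fun k => by positivity)
  have hdb : ∀ k, ‖d k‖ ≤ (‖c‖ + 1) * (1 / 4) ^ k := by
    intro k
    rcases Nat.eq_zero_or_pos k with rfl | hk
    · have := norm_sub_norm_le (d 0) c
      have h1 : ‖d 0 - c‖ < 1 := by
        rw [norm_sub_rev, ← neg_add_eq_sub]; simpa using hd0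
      simp only [pow_zero, mul_one]
      linarith
    · refine (hdn k hk).le.trans (le_mul_of_one_le_left (by positivity) ?_)
      linarith [norm_nonneg c]
  choose F hF using fun k => E.exists_proj_mul_eq (hdS k)
  have hdF : ∀ k, d k * E.proj (F k) = d k := fun k => (hF k (F k) subset_rfl).2
  -- These partial isometries carry the coordinates in `F k` into the corner at `o`, with mutually
  -- orthogonal ranges for different `k`.
  let V : ℕ → B := fun k => ∑ i ∈ F k, E.entry o i (s (k, i))
  have hV : ∀ k l, star (V k) * V l = if k = l then E.proj (F k) else 0 := by
    intro k l
    simp only [V, star_sum, E.star_entry, Finset.sum_mul, Finset.mul_sum, entry_mul_entry_same, hs,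
      Prod.mk.injEq]
    split_ifs with h
    · subst h
      rw [proj]
      refine Finset.sum_congr rfl fun i hi => ?_
      rw [Finset.sum_eq_single_of_mem i hi]
      · simp
      · intro j _ hj
        simp [hj]
    · simp [h]
  have hVo : ∀ k, E.entry o o 1 * V k = V k := by
    intro k
    simp only [V, Finset.mul_sum, entry_mul_entry_same, one_mul]
  have hVn : ∀ k, ‖V k‖ ≤ 1 := by
    intro k
    have h1 : ‖V k‖ * ‖V k‖ ≤ 1 := by
      rw [← CStarRing.norm_star_mul_self, hV, if_pos rfl]
      exact E.norm_proj_le _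
    nlinarith [norm_nonneg (V k)]
  have h2 : ∀ k : ℕ, ‖(2 : ℂ) ^ k‖ = 2 ^ k := fun k => by simp
  -- The weights `2^k` and `2^(-k)` cancel in `X * Y`. The first is absorbed by the decay of `d k`,
  -- and the second makes the series of the `V k` converge.
  have hX : Summable fun k => (2 : ℂ) ^ k • (d k * star (V k)) := by
    refine Summable.of_norm_bounded (g := fun k : ℕ => (‖c‖ + 1) * (1 / 2) ^ k)
      (summable_geometric_two.mul_left _) fun k => ?_
    rw [norm_smul, h2]
    calc _ ≤ 2 ^ k * (((‖c‖ + 1) * (1 / 4) ^ k) * 1) := by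
          gcongr
          refine norm_mul_le_of_le (hdb k) ?_
          rw [norm_star]; exact hVn k
      _ = (‖c‖ + 1) * (2 * (1 / 4)) ^ k := by rw [mul_pow]; ring
      _ = _ := by norm_num
  have hY : Summable fun k => ((2 : ℂ) ^ k)⁻¹ • V k := by
    refine Summable.of_norm_bounded (g := fun k : ℕ => (1 / 2 : ℝ) ^ k)
      summable_geometric_two fun k => ?_
    rw [norm_smul, norm_inv, h2]
    calc _ ≤ ((2 : ℝ) ^ k)⁻¹ * 1 := by gcongr; exact hVn k
      _ = _ := by simp
  set X := ∑' k, (2 : ℂ) ^ k • (d k * star (V k)) with hXdef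
  set Y := ∑' k, ((2 : ℂ) ^ k)⁻¹ • V k with hYdef
  have hVY : ∀ k, star (V k) * Y = ((2 : ℂ) ^ k)⁻¹ • E.proj (F k) := by
    intro k
    rw [hYdef, ← hY.tsum_mul_left, tsum_eq_single k]
    · rw [mul_smul_comm, hV, if_pos rfl]
    · intro l hl
      rw [mul_smul_comm, hV, if_neg hl.symm, smul_zero]
  have hoY : E.entry o o 1 * Y = Y := by
    rw [hYdef, ← hY.tsum_mul_left]
    simp only [mul_smul_comm, hVo]
  have hXY : X * Y = ∑' k, d k := by
    rw [hXdef, ← hX.tsum_mul_right]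
    refine tsum_congr fun k => ?_
    rw [smul_mul_assoc, mul_assoc, hVY, mul_smul_comm, hdF, smul_smul,
      mul_inv_cancel₀ (pow_ne_zero _ two_ne_zero), one_smul]
  have hdsum : Summable d := Summable.of_norm_bounded
    (g := fun k : ℕ => (‖c‖ + 1) * (1 / 4) ^ k)
    ((summable_geometric_of_lt_one (by norm_num) (by norm_num)).mul_left _) hdb
  refine ⟨X, Y, ?_⟩
  rw [mul_assoc, hoY, hXY]
  exact tendsto_nhds_unique (hdsum.hasSum.tendsto_sum_nat.comp (tendsto_add_atTop_nat 1)) hd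

/-- An algebra with matrix units over a purely infinite unital algebra is purely infinite. -/
theorem isPurelyInfiniteSimple (hD : ∀ a : D, a ≠ 0 → ∃ x y : D, x * a * y = 1) {o : I}
    (ho : E.entry o o 1 ≠ 0) {s : ℕ × I → D}
    (hs : ∀ p q, star (s p) * s q = if p = q then 1 else 0) : IsPurelyInfiniteSimple B := by
  have : Nontrivial B := ⟨_, _, ho⟩
  refine isPurelyInfiniteSimple_of_forall fun b c hb => ?_
  obtain ⟨x, y, hxy⟩ := E.exists_mul_mul_eq_entry hD ho hb
  obtain ⟨x', y', hxy'⟩ := E.exists_mul_entry_mul_eq hs o c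
  refine ⟨x' * x, y * y', ?_⟩
  rw [← hxy', ← hxy]
  simp only [mul_assoc]

/-- Matrix units over `D` whose span is dense in the C⋆-algebra generated by a set. -/
noncomputable def ofAdjoin {M : Type*} [NonUnitalCStarAlgebra M] (S : Set M) (e : I → I → D →ₗ[ℂ] M)
    (hmul : ∀ i j k l a b, e i j a * e k l b = if j = k then e i l (a * b) else 0)
    (hstar : ∀ i j a, star (e i j a) = e j i (star a)) (he : ∀ i j a, e i j a ∈ S)
    (hS : S ⊆ closure (Submodule.span ℂ {b | ∃ i j a, e i j a = b} : Set M))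
    [IsClosed ((NonUnitalStarAlgebra.adjoin ℂ S).topologicalClosure : Set M)] :
    MatrixSystem I D (NonUnitalStarAlgebra.adjoin ℂ S).topologicalClosure where
  entry i j :=
    { toFun := fun d => ⟨e i j d, NonUnitalStarSubalgebra.le_topologicalClosure _
        (NonUnitalStarAlgebra.subset_adjoin ℂ _ (he i j d))⟩
      map_add' := fun a b => Subtype.ext (map_add (e i j) a b)
      map_smul' := fun c a => Subtype.ext (map_smul (e i j) c a) }
  entry_mul_entry i j k l a b := Subtype.ext <| by
    have := hmul i j k l a b
    split_ifs with h
    · rw [if_pos h] at this; exact this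
    · rw [if_neg h] at this; exact this
  star_entry i j a := Subtype.ext (hstar i j a)
  dense_span := fun b => by
    set K := Submodule.span ℂ {b | ∃ i j a, e i j a = b} with hK
    have hKmul : ∀ x ∈ K, ∀ y ∈ K, x * y ∈ K := by
      intro x hx y hy
      induction hx using Submodule.span_induction with
      | zero => rw [zero_mul]; exact zero_mem _
      | add x x' _ _ h h' => rw [add_mul]; exact add_mem h h'
      | smul c x _ h => rw [smul_mul_assoc]; exact Submodule.smul_mem _ c h
      | mem x hx =>
        obtain ⟨i, j, a, rfl⟩ := hx
        induction hy using Submodule.span_induction with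
        | zero => rw [mul_zero]; exact zero_mem _
        | add x x' _ _ h h' => rw [mul_add]; exact add_mem h h'
        | smul c x _ h => rw [mul_smul_comm]; exact Submodule.smul_mem _ c h
        | mem y hy =>
          obtain ⟨k, l, b, rfl⟩ := hy
          rw [hmul]
          split_ifs
          · exact Submodule.subset_span ⟨i, l, a * b, rfl⟩
          · exact zero_mem _
    have hKstar : ∀ x ∈ K, star x ∈ K := by
      intro x hx
      induction hx using Submodule.span_induction with
      | zero => rw [star_zero]; exact zero_mem _
      | add x x' _ _ h h' => rw [star_add]; exact add_mem h h'
      | smul c x _ h => rw [star_smul]; exact Submodule.smul_mem _ _ h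
      | mem x hx =>
        obtain ⟨i, j, a, rfl⟩ := hx
        rw [hstar]
        exact Submodule.subset_span ⟨j, i, star a, rfl⟩
    -- `K` is closed under products and stars, so its closure is a star algebra containing `S`.
    have hsub : ((NonUnitalStarAlgebra.adjoin ℂ S).topologicalClosure : Set M) ⊆ closure K := by
      refine closure_minimal (fun x hx => ?_) isClosed_closure
      change x ∈ K.topologicalClosure
      induction hx using NonUnitalStarAlgebra.adjoin_induction with
      | mem x hx => exact hS hx
      | add x y _ _ hx hy => exact add_mem hx hy
      | zero => exact zero_mem _
      | mul x y _ _ hx hy => exact map_mem_closure₂ continuous_mul hx hy hKmul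
      | smul c x _ hx => exact Submodule.smul_mem _ c hx
      | star x _ hx => exact map_mem_closure continuous_star hx hKstar
    rw [closure_subtype]
    refine closure_mono (fun z hz => ?_) (hsub b.2)
    induction hz using Submodule.span_induction with
    | zero => exact ⟨0, zero_mem _, rfl⟩
    | add x y _ _ hx hy =>
      obtain ⟨x, hx, rfl⟩ := hx
      obtain ⟨y, hy, rfl⟩ := hy
      exact ⟨x + y, add_mem hx hy, rfl⟩
    | smul c x _ hx =>
      obtain ⟨x, hx, rfl⟩ := hx
      exact ⟨c • x, Submodule.smul_mem _ c hx, rfl⟩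
    | mem x hx =>
      obtain ⟨i, j, d, rfl⟩ := hx
      exact ⟨_, Submodule.subset_span ⟨i, j, d, rfl⟩, rfl⟩

theorem isPurelyInfiniteSimple_adjoin {M : Type*} [NonUnitalCStarAlgebra M] (S : Set M)
    (e : I → I → D →ₗ[ℂ] M)
    (hmul : ∀ i j k l a b, e i j a * e k l b = if j = k then e i l (a * b) else 0)
    (hstar : ∀ i j a, star (e i j a) = e j i (star a)) (he : ∀ i j a, e i j a ∈ S)
    (hS : S ⊆ closure (Submodule.span ℂ {b | ∃ i j a, e i j a = b} : Set M))
    [IsClosed ((NonUnitalStarAlgebra.adjoin ℂ S).topologicalClosure : Set M)]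
    (hD : ∀ a : D, a ≠ 0 → ∃ x y : D, x * a * y = 1) {o : I} (ho : e o o 1 ≠ 0)
    {s : ℕ × I → D} (hs : ∀ p q, star (s p) * s q = if p = q then 1 else 0) :
    IsPurelyInfiniteSimple (NonUnitalStarAlgebra.adjoin ℂ S).topologicalClosure :=
  (ofAdjoin S e hmul hstar he hS).isPurelyInfiniteSimple hD
    (o := o) (fun h => ho (congrArg Subtype.val h)) hs

end MatrixSystem

end MatrixUnits

/-! ### Matrix units in the crossed product -/

namespace CircleAction

variable {A : Type u} [CStarAlgebra A]

theorem monomial_add (n : ℤ) (a b : A) : monomial n (a + b) = monomial n a + monomial n b := by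
  ext ζ; simp

theorem monomial_smul (n : ℤ) (c : ℂ) (a : A) : monomial n (c • a) = c • monomial n a := by
  ext ζ; simp [smul_smul, mul_comm]

theorem norm_monomial_le (n : ℤ) (a : A) : ‖monomial n a‖ ≤ ‖a‖ :=
  (ContinuousMap.norm_le _ (norm_nonneg a)).mpr fun ζ => by
    rw [monomial_apply, norm_smul, norm_zpow_coe, one_mul]

/-- A closed subspace of `C(𝕋, A)` that contains all monomials is everything. -/
theorem mem_of_monomial_mem (M : Submodule ℂ C(Circle, A)) (hM : IsClosed (M : Set C(Circle, A)))
    (h : ∀ n a, monomial n a ∈ M) (f : C(Circle, A)) : f ∈ M := by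
  -- The Fourier coefficients of the translation curve `η ↦ f(η ·)` in `C(𝕋, A)` are monomials, and
  -- the curve passes through `f` at `η = 1`.
  let G : C(Circle × Circle, A) := ⟨fun p => f (p.1 * p.2), by fun_prop⟩
  let F : C(Circle, C(Circle, A)) := G.curry
  have hF : ∀ η ζ, F η ζ = f (η * ζ) := fun _ _ => rfl
  have hF1 : F 1 = f := by ext ζ; rw [hF, one_mul]
  rw [← hF1]
  refine apply_one_mem_of_fourier_mem M hM F.continuous fun n => ?_
  have hmon : ∫ η : Circle, (η : ℂ) ^ n • F η ∂haarCircle =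
      monomial (-n) (∫ η : Circle, (η : ℂ) ^ n • f η ∂haarCircle) := by
    ext ζ
    have h1 := (ContinuousMap.evalCLM ℂ ζ : C(Circle, A) →L[ℂ] A).integral_comp_comm
      (integrable_of_continuous ((character n).continuous.smul F.continuous))
    have h2 : (∫ η : Circle, (η : ℂ) ^ n • F η ∂haarCircle) ζ =
        ∫ η : Circle, (η : ℂ) ^ n • f (η * ζ) ∂haarCircle := h1.symm
    have h3 := integral_mul_right_eq_self (μ := haarCircle)
      (fun η : Circle => (η : ℂ) ^ n • f η) ζ
    rw [h2, monomial_apply, ← h3, ← integral_smul]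
    refine integral_congr_ae (.of_forall fun η => ?_)
    simp only [Circle.coe_mul, mul_zpow, smul_smul]
    rw [mul_comm ((η : ℂ) ^ n), ← mul_assoc, ← zpow_add₀ (Circle.coe_ne_zero ζ), neg_add_cancel,
      zpow_zero, one_mul]
  rw [hmon]
  exact h _ _

variable {α : CircleAction A}

/-! ### Integrated forms and isotypic projections -/

namespace CovariantRep

variable (ρ : CovariantRep α)

theorem integrated_apply (f : C(Circle, A)) (ξ : ρ.H) :
    ρ.integrated f ξ = ∫ ζ, ρ.π (f ζ) ((ρ.U ζ : ρ.H →L[ℂ] ρ.H) ξ) ∂haarCircle := rfl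

theorem integrated_add (f g : C(Circle, A)) :
    ρ.integrated (f + g) = ρ.integrated f + ρ.integrated g := by
  ext ξ
  rw [add_apply]
  simp only [integrated_apply, ContinuousMap.add_apply, map_add, add_apply]
  exact integral_add (ρ.integrable_integrand f ξ) (ρ.integrable_integrand g ξ)

theorem integrated_smul (c : ℂ) (f : C(Circle, A)) :
    ρ.integrated (c • f) = c • ρ.integrated f := by
  ext ξ
  rw [smul_apply]
  simp only [integrated_apply, ContinuousMap.smul_apply, map_smul, smul_apply]
  exact integral_smul c _

theorem continuous_zpow_smul_U (n : ℤ) (ξ : ρ.H) :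
    Continuous fun ζ : Circle => (ζ : ℂ) ^ n • (ρ.U ζ : ρ.H →L[ℂ] ρ.H) ξ :=
  (character n).continuous.smul (ρ.continuous_U ξ)

/-- The projection onto the isotypic subspace of the character `ζ ↦ ζ ^ n`. -/
noncomputable def isotypicProj (n : ℤ) : ρ.H →L[ℂ] ρ.H := ρ.integrated (monomial (-n) 1)

theorem isotypicProj_apply (n : ℤ) (ξ : ρ.H) :
    ρ.isotypicProj n ξ =
      ∫ ζ : Circle, (ζ : ℂ) ^ (-n) • (ρ.U ζ : ρ.H →L[ℂ] ρ.H) ξ ∂haarCircle := by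
  rw [isotypicProj, integrated_apply]
  simp only [monomial_apply, map_smul, map_one, smul_apply,
    one_apply_eq_self]

theorem integrated_monomial (n : ℤ) (a : A) :
    ρ.integrated (monomial (-n) a) = ρ.π a * ρ.isotypicProj n := by
  ext ξ
  rw [mul_apply_eq_comp, isotypicProj_apply, integrated_apply,
    ← (ρ.π a).integral_comp_comm (integrable_of_continuous (ρ.continuous_zpow_smul_U _ ξ))]
  simp only [monomial_apply, map_smul, smul_apply]

theorem U_mul_apply (η ζ : Circle) (ξ : ρ.H) :
    (ρ.U (η * ζ) : ρ.H →L[ℂ] ρ.H) ξ = (ρ.U η : ρ.H →L[ℂ] ρ.H) ((ρ.U ζ : ρ.H →L[ℂ] ρ.H) ξ) := by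
  rw [map_mul]; rfl

theorem U_isotypicProj (η : Circle) (n : ℤ) (ξ : ρ.H) :
    (ρ.U η : ρ.H →L[ℂ] ρ.H) (ρ.isotypicProj n ξ) = (η : ℂ) ^ n • ρ.isotypicProj n ξ := by
  rw [isotypicProj_apply, ← ContinuousLinearMap.integral_comp_comm _
    (integrable_of_continuous (ρ.continuous_zpow_smul_U _ ξ))]
  have h := integral_mul_left_eq_self (μ := haarCircle)
    (fun ζ : Circle => (ζ : ℂ) ^ (-n) • (ρ.U ζ : ρ.H →L[ℂ] ρ.H) ξ) η
  rw [← h, ← integral_smul]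
  refine integral_congr_ae (.of_forall fun ζ => ?_)
  simp only [map_smul, Circle.coe_mul, mul_zpow, smul_smul]
  rw [← mul_assoc, ← zpow_add₀ (Circle.coe_ne_zero η), add_neg_cancel, zpow_zero, one_mul,
    U_mul_apply]

theorem isotypicProj_mul_isotypicProj (m n : ℤ) :
    ρ.isotypicProj m * ρ.isotypicProj n = if m = n then ρ.isotypicProj n else 0 := by
  ext ξ
  rw [mul_apply_eq_comp, isotypicProj_apply]
  simp only [U_isotypicProj, smul_smul]
  rw [integral_smul_const]
  have : ∀ ζ : Circle, (ζ : ℂ) ^ (-m) * (ζ : ℂ) ^ n = (ζ : ℂ) ^ (n - m) := fun ζ => by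
    rw [← zpow_add₀ (Circle.coe_ne_zero ζ), neg_add_eq_sub]
  simp only [this]
  rw [integral_zpow]
  by_cases h : m = n
  · simp [h]
  · simp [h, sub_eq_zero, Ne.symm h]

theorem inner_U_left (ζ : Circle) (ξ η : ρ.H) :
    inner ℂ ((ρ.U ζ : ρ.H →L[ℂ] ρ.H) ξ) η = inner ℂ ξ ((ρ.U ζ⁻¹ : ρ.H →L[ℂ] ρ.H) η) := by
  rw [map_inv, ← Unitary.star_eq_inv, Unitary.coe_star, ContinuousLinearMap.star_eq_adjoint,
    ContinuousLinearMap.adjoint_inner_right]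

theorem star_isotypicProj (n : ℤ) : star (ρ.isotypicProj n) = ρ.isotypicProj n := by
  rw [ContinuousLinearMap.star_eq_adjoint, eq_comm, ContinuousLinearMap.eq_adjoint_iff]
  intro ξ η
  rw [isotypicProj_apply, isotypicProj_apply,
    ← integral_inner (integrable_of_continuous (ρ.continuous_zpow_smul_U _ η)),
    ← inner_conj_symm,
    ← integral_inner (integrable_of_continuous (ρ.continuous_zpow_smul_U _ ξ)),
    ← integral_conj, ← integral_inv_eq_self _ haarCircle]
  refine integral_congr_ae (.of_forall fun ζ => ?_)
  beta_reduce
  rw [inner_conj_symm, inner_smul_left, inner_smul_right, inner_U_left, inv_inv]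
  congr 1
  rw [Circle.coe_inv, inv_zpow, map_inv₀, map_zpow₀, ← Circle.coe_inv_eq_conj, Circle.coe_inv,
    inv_zpow, inv_inv]

/-- Covariance gives `U_ζ π(a) = ζ^k π(a) U_ζ`: elements of degree `k` shift isotypic components by
`k`. -/
theorem isotypicProj_mul_π (n : ℤ) {k : ℤ} {a : A} (ha : a ∈ α.spectralSubspace k) :
    ρ.isotypicProj n * ρ.π a = ρ.π a * ρ.isotypicProj (n - k) := by
  ext ξ
  rw [mul_apply_eq_comp, mul_apply_eq_comp, isotypicProj_apply,
    isotypicProj_apply,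
    ← (ρ.π a).integral_comp_comm (integrable_of_continuous (ρ.continuous_zpow_smul_U _ ξ))]
  refine integral_congr_ae (.of_forall fun ζ => ?_)
  have hcov : (ρ.U ζ : ρ.H →L[ℂ] ρ.H) * ρ.π a =
      (ζ : ℂ) ^ k • (ρ.π a * (ρ.U ζ : ρ.H →L[ℂ] ρ.H)) := by
    have h1 := ρ.covariant ζ a
    rw [ha ζ, map_smul] at h1
    rw [← smul_mul_assoc, ← h1, mul_assoc, (Unitary.mem_iff.mp (ρ.U ζ).2).1, mul_one]
  have hcov' := congrArg (fun T : ρ.H →L[ℂ] ρ.H => T ξ) hcov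
  simp only [mul_apply_eq_comp, smul_apply] at hcov'
  beta_reduce
  rw [hcov', map_smul, smul_smul, ← zpow_add₀ (Circle.coe_ne_zero ζ)]
  congr 2
  ring

end CovariantRep

variable (α) in
/-- The universal integrated form as a linear map. -/
noncomputable def universalRepLinear :
    C(Circle, A) →ₗ[ℂ] lp (fun ρ : CovariantRep α => ρ.H →L[ℂ] ρ.H) ∞ where
  toFun := α.universalRep
  map_add' f g := lp.ext (funext fun ρ => ρ.integrated_add f g)
  map_smul' c f := lp.ext (funext fun ρ => ρ.integrated_smul c f)

variable (α) in
theorem continuous_universalRepLinear : Continuous α.universalRepLinear :=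
  AddMonoidHomClass.continuous_of_bound _ 1 fun f => by
    rw [one_mul]
    exact lp.norm_le_of_forall_le (norm_nonneg f) fun ρ => ρ.norm_integrated_le f

/-! ### Matrix entries built from an eigenunitary -/

section MatrixUnits

variable {v : unitary A}

/-- The element `v ^ i * d * v ^ (-j)`. -/
noncomputable def conjugate (v : unitary A) (i j : ℤ) (d : A) : A :=
  ((v ^ i : unitary A) : A) * d * ((v ^ (-j) : unitary A) : A)

theorem conjugate_mem_spectralSubspace (hv : v ∈ α.eigenunitaries) (i j : ℤ) {d : A}
    (hd : d ∈ α.fixedPoints) : conjugate v i j d ∈ α.spectralSubspace (i - j) := by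
  have := mul_mem_spectralSubspace (mul_mem_spectralSubspace (zpow_mem_spectralSubspace hv i)
    (α.mem_spectralSubspace_zero.mpr hd)) (zpow_mem_spectralSubspace hv (-j))
  rwa [add_zero, ← sub_eq_add_neg] at this

theorem coe_zpow_mul_coe_zpow (v : unitary A) (i j : ℤ) :
    ((v ^ i : unitary A) : A) * ((v ^ j : unitary A) : A) = ((v ^ (i + j) : unitary A) : A) := by
  rw [zpow_add]; rfl

theorem conjugate_mul_conjugate (v : unitary A) (i j k : ℤ) (a b : A) :
    conjugate v i j a * conjugate v j k b = conjugate v i k (a * b) := by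
  have : conjugate v i j a * conjugate v j k b = ((v ^ i : unitary A) : A) * a *
      (((v ^ (-j) : unitary A) : A) * ((v ^ j : unitary A) : A)) * b *
      ((v ^ (-k) : unitary A) : A) := by
    simp only [conjugate, mul_assoc]
  rw [this, coe_zpow_mul_coe_zpow, neg_add_cancel, zpow_zero]
  simp [conjugate, mul_assoc]

theorem star_conjugate (v : unitary A) (i j : ℤ) (a : A) :
    star (conjugate v i j a) = conjugate v j i (star a) := by
  have h : ∀ n : ℤ, star ((v ^ n : unitary A) : A) = ((v ^ (-n) : unitary A) : A) := fun n => by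
    rw [← Unitary.coe_star, Unitary.star_eq_inv, zpow_neg]
  rw [conjugate, conjugate, star_mul, star_mul, h, h, neg_neg, mul_assoc]

theorem conjugate_conjugate (v : unitary A) (i j k l : ℤ) (a : A) :
    conjugate v i j (conjugate v k l a) = conjugate v (i + k) (j + l) a := by
  have : conjugate v i j (conjugate v k l a) =
      (((v ^ i : unitary A) : A) * ((v ^ k : unitary A) : A)) * a *
      (((v ^ (-l) : unitary A) : A) * ((v ^ (-j) : unitary A) : A)) := by
    simp only [conjugate, mul_assoc]
  rw [this, coe_zpow_mul_coe_zpow, coe_zpow_mul_coe_zpow, ← neg_add_rev, conjugate]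

/-- The matrix entries of the crossed product, before restricting the codomain. -/
noncomputable def matrixEntry (α : CircleAction A) (v : unitary A) (i j : ℤ) (d : A) :
    lp (fun ρ : CovariantRep α => ρ.H →L[ℂ] ρ.H) ∞ :=
  α.universalRep (monomial (-j) (conjugate v i j d))

/-- For fixed `d` and an eigenunitary `v`, the coefficient has degree `i - j`, so the operator maps
the isotypic component `j` into the component `i`. This is the source of the matrix relations. -/
theorem matrixEntry_apply (v : unitary A) (i j : ℤ) (d : A) (ρ : CovariantRep α) :
    matrixEntry α v i j d ρ = ρ.π (conjugate v i j d) * ρ.isotypicProj j :=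
  ρ.integrated_monomial j _

theorem matrixEntry_mul_matrixEntry (hv : v ∈ α.eigenunitaries) (i j k l : ℤ) (a : A) {b : A}
    (hb : b ∈ α.fixedPoints) : matrixEntry α v i j a * matrixEntry α v k l b =
      if j = k then matrixEntry α v i l (a * b) else 0 := by
  refine lp.ext (funext fun ρ => ?_)
  rw [lp.infty_coeFn_mul, Pi.mul_apply, matrixEntry_apply, matrixEntry_apply]
  have h1 : ρ.π (conjugate v i j a) * ρ.isotypicProj j *
      (ρ.π (conjugate v k l b) * ρ.isotypicProj l) =
      ρ.π (conjugate v i j a * conjugate v k l b) *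
        (ρ.isotypicProj (j - (k - l)) * ρ.isotypicProj l) := by
    rw [mul_assoc, ← mul_assoc (ρ.isotypicProj j),
      ρ.isotypicProj_mul_π j (conjugate_mem_spectralSubspace hv k l hb), map_mul]
    simp only [mul_assoc]
  rw [h1, ρ.isotypicProj_mul_isotypicProj]
  by_cases hjk : j = k
  · subst hjk
    rw [if_pos (by ring), if_pos rfl, matrixEntry_apply, conjugate_mul_conjugate]
  · rw [if_neg (fun h => hjk (by linarith)), if_neg hjk, mul_zero]
    rfl

theorem star_matrixEntry (hv : v ∈ α.eigenunitaries) (i j : ℤ) {a : A}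
    (ha : a ∈ α.fixedPoints) :
    star (matrixEntry α v i j a) = matrixEntry α v j i (star a) := by
  refine lp.ext (funext fun ρ => ?_)
  rw [lp.coeFn_star, Pi.star_apply, matrixEntry_apply, matrixEntry_apply, star_mul,
    ρ.star_isotypicProj, ← map_star, star_conjugate,
    ρ.isotypicProj_mul_π j (conjugate_mem_spectralSubspace hv j i (star_mem ha))]
  congr 2
  ring

/-- A linear map on `C(𝕋, A)` takes values in a closed subspace as soon as it maps the monomials
with homogeneous coefficients there. -/
theorem map_mem_of_homogeneous {M : Type*} [NormedAddCommGroup M] [NormedSpace ℂ M]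
    (α : CircleAction A) (R : C(Circle, A) →ₗ[ℂ] M) (hR : Continuous R) (K : Submodule ℂ M)
    (hK : IsClosed (K : Set M))
    (h : ∀ n k, ∀ a ∈ α.spectralSubspace k, R (monomial n a) ∈ K) (f : C(Circle, A)) :
    R f ∈ K := by
  refine mem_of_monomial_mem (K.comap R) (hK.preimage hR) (fun n a => ?_) f
  let L : A →ₗ[ℂ] C(Circle, A) :=
    { toFun := monomial n
      map_add' := monomial_add n
      map_smul' := monomial_smul n }
  have hL : Continuous L := AddMonoidHomClass.continuous_of_bound L 1 fun a => by
    rw [one_mul]; exact norm_monomial_le n a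
  have hsub : (⨆ k, α.spectralSubspace k) ≤ K.comap (R ∘ₗ L) := iSup_le fun k a ha => h n k a ha
  exact closure_minimal hsub (hK.preimage (hR.comp hL)) (α.dense_iSup_spectralSubspace a)

/-- The monomial exponent `n` forces the column `-n`, and the degree `k` then forces the row `k -
n`. Undoing the conjugation leaves the invariant element `v^(n-k) a v^(-n)`. -/
theorem exists_matrixEntry_eq (hv : v ∈ α.eigenunitaries) (n k : ℤ) {a : A}
    (ha : a ∈ α.spectralSubspace k) :
    ∃ (i j : ℤ) (d : α.fixedPoints), matrixEntry α v i j d = α.universalRep (monomial n a) := by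
  have hd : conjugate v (n - k) n a ∈ α.fixedPoints := by
    rw [← mem_spectralSubspace_zero]
    have := mul_mem_spectralSubspace (mul_mem_spectralSubspace
      (zpow_mem_spectralSubspace hv (n - k)) ha) (zpow_mem_spectralSubspace hv (-n))
    have e : n - k + k + -n = 0 := by ring
    rwa [e] at this
  refine ⟨-n + k, -n, ⟨_, hd⟩, ?_⟩
  rw [matrixEntry, conjugate_conjugate, neg_neg]
  have e : -n + k + (n - k) = 0 := by ring
  rw [e, neg_add_cancel]
  simp only [conjugate, neg_zero, zpow_zero, OneMemClass.coe_one, one_mul, mul_one]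

/-- The matrix entries as linear maps on the fixed point algebra. -/
noncomputable def matrixEntryLinear (α : CircleAction A) (v : unitary A) (i j : ℤ) :
    α.fixedPoints →ₗ[ℂ] lp (fun ρ : CovariantRep α => ρ.H →L[ℂ] ρ.H) ∞ :=
  α.universalRepLinear ∘ₗ
    { toFun := fun d => monomial (-j) (conjugate v i j (d : A))
      map_add' := fun a b => by
        rw [← monomial_add]
        simp only [conjugate, AddMemClass.coe_add, mul_add, add_mul]
      map_smul' := fun c a => by
        rw [RingHom.id_apply, ← monomial_smul]
        simp only [conjugate, SetLike.val_smul, mul_smul_comm, smul_mul_assoc] }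

/-- In any covariant representation this entry is `p_0`, which fixes every `U`-invariant vector. -/
theorem matrixEntryLinear_one_ne_zero (v : unitary A)
    (hρ : ∃ (ρ : CovariantRep α) (ξ : ρ.H), ξ ≠ 0 ∧ ∀ ζ, (ρ.U ζ : ρ.H →L[ℂ] ρ.H) ξ = ξ) :
    matrixEntryLinear α v 0 0 1 ≠ 0 := by
  obtain ⟨ρ, ξ, hξ, hU⟩ := hρ
  intro h
  have h1 : matrixEntry α v 0 0 1 = 0 := h
  have h2 : ρ.π (conjugate v 0 0 1) * ρ.isotypicProj 0 = 0 := by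
    rw [← matrixEntry_apply, h1]; rfl
  have h3 : conjugate v 0 0 (1 : A) = 1 := by simp [conjugate]
  rw [h3, map_one, one_mul] at h2
  apply hξ
  have h4 : ρ.isotypicProj 0 ξ = ξ := by
    rw [ρ.isotypicProj_apply]
    simp [hU]
  rw [← h4, h2]
  rfl

/-- The crossed product is purely infinite simple if there are an eigenunitary, a covariant
representation with a nonzero invariant vector, and enough isometries in the fixed point algebra,
in which every nonzero element can be cut down to the unit. -/
theorem isPurelyInfiniteSimple_crossedProduct (hv : v ∈ α.eigenunitaries)
    (hρ : ∃ (ρ : CovariantRep α) (ξ : ρ.H), ξ ≠ 0 ∧ ∀ ζ, (ρ.U ζ : ρ.H →L[ℂ] ρ.H) ξ = ξ)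
    (hD : ∀ a : α.fixedPoints, a ≠ 0 → ∃ x y : α.fixedPoints, x * a * y = 1)
    {s : ℕ × ℤ → α.fixedPoints} (hs : ∀ p q, star (s p) * s q = if p = q then 1 else 0) :
    IsPurelyInfiniteSimple α.crossedProduct := by
  have : IsClosed ((NonUnitalStarAlgebra.adjoin ℂ
      (Set.range α.universalRep)).topologicalClosure : Set
        (lp (fun ρ : CovariantRep α => ρ.H →L[ℂ] ρ.H) ∞)) := α.isClosed_crossedProduct
  refine MatrixSystem.isPurelyInfiniteSimple_adjoin (Set.range α.universalRep)
    (matrixEntryLinear α v) (fun i j k l a b => matrixEntry_mul_matrixEntry hv i j k l a b.2)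
    (fun i j a => star_matrixEntry hv i j a.2) (fun i j a => ⟨_, rfl⟩) ?_ hD
    (matrixEntryLinear_one_ne_zero v hρ) hs
  rintro - ⟨f, rfl⟩
  refine map_mem_of_homogeneous α α.universalRepLinear α.continuous_universalRepLinear
    (Submodule.topologicalClosure _) (Submodule.isClosed_topologicalClosure _)
    (fun n k a ha => Submodule.le_topologicalClosure _ (Submodule.subset_span ?_)) f
  exact exists_matrixEntry_eq hv n k ha

end MatrixUnits

end CircleAction

/-! ### A covariant representation with an invariant vector -/

open scoped ComplexOrder

/-- A unital contractive functional is positive. -/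
theorem nonneg_of_norm_le_of_map_one {A : Type*} [CStarAlgebra A] [PartialOrder A]
    [StarOrderedRing A] (g : A →ₗ[ℂ] ℂ) (hg : ∀ a, ‖g a‖ ≤ ‖a‖) (hg1 : g 1 = 1) {a : A}
    (ha : 0 ≤ a) : 0 ≤ g a := by
  have hnt : Nontrivial A := by
    by_contra h
    rw [not_nontrivial_iff_subsingleton] at h
    have : (1 : A) = 0 := Subsingleton.elim _ _
    rw [this, map_zero] at hg1
    exact zero_ne_one hg1
  have hsa : IsSelfAdjoint a := .of_nonneg ha
  have him : (g a).im = 0 := by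
    -- Compare `|g(a + it)|²` with `‖a + it‖² ≤ ‖a‖² + t²`: the terms `t²` cancel, and the remaining
    -- linear bound in `t` forces `Im g(a) = 0`.
    have key : ∀ t : ℝ, 2 * t * (g a).im ≤ ‖a‖ ^ 2 := by
      intro t
      have h1 := hg (a + ((t : ℂ) * Complex.I) • 1)
      rw [map_add, map_smul, hg1, smul_eq_mul, mul_one] at h1
      have h2 : ‖a + ((t : ℂ) * Complex.I) • (1 : A)‖ ^ 2 ≤ ‖a‖ ^ 2 + t ^ 2 := by
        rw [pow_two, ← CStarRing.norm_star_mul_self]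
        have : star (a + ((t : ℂ) * Complex.I) • (1 : A)) * (a + ((t : ℂ) * Complex.I) • 1) =
            a * a + ((t : ℂ) ^ 2) • (1 : A) := by
          rw [star_add, hsa.star_eq, star_smul, star_one]
          simp only [star_mul', Complex.star_def, Complex.conj_ofReal, Complex.conj_I, add_mul,
            mul_add, smul_mul_assoc, mul_smul_comm, one_mul, mul_one, smul_add, smul_smul]
          have e : (t : ℂ) * Complex.I * ((t : ℂ) * -Complex.I) = (t : ℂ) ^ 2 := by
            linear_combination (-(t : ℂ) ^ 2) * Complex.I_sq
          rw [e, mul_neg, neg_smul]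
          abel
        rw [this]
        refine (norm_add_le _ _).trans (add_le_add ?_ ?_)
        · rw [pow_two]; exact norm_mul_le _ _
        · rw [norm_smul, norm_one, mul_one, norm_pow, Complex.norm_real, Real.norm_eq_abs, sq_abs]
      have h3 : ‖g a + (t : ℂ) * Complex.I‖ ^ 2 = (g a).re ^ 2 + ((g a).im + t) ^ 2 := by
        rw [← Complex.normSq_eq_norm_sq, Complex.normSq_apply]
        simp
        ring
      have h4 : ‖g a + (t : ℂ) * Complex.I‖ ^ 2 ≤ ‖a‖ ^ 2 + t ^ 2 :=
        (pow_le_pow_left₀ (norm_nonneg _) h1 2).trans h2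
      nlinarith [sq_nonneg (g a).re, sq_nonneg (g a).im]
    by_contra hne
    have := key ((‖a‖ ^ 2 + 1) / (g a).im)
    have e : 2 * ((‖a‖ ^ 2 + 1) / (g a).im) * (g a).im = 2 * (‖a‖ ^ 2 + 1) := by field_simp
    rw [e] at this
    nlinarith [sq_nonneg ‖a‖]
  have hre : 0 ≤ (g a).re := by
    set r := ‖a‖ with hr
    -- From `0 ≤ a ≤ r`; contractivity then gives `r - Re g(a) ≤ r`.
    have h1 : ‖algebraMap ℝ A r - a‖ ≤ r := by
      have hle : a ≤ algebraMap ℝ A r := hsa.le_algebraMap_norm_self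
      refine (CStarAlgebra.norm_le_norm_of_nonneg_of_le (b := algebraMap ℝ A r)
        (sub_nonneg.mpr hle) (sub_le_self _ ha)).trans ?_
      rw [norm_algebraMap', Real.norm_of_nonneg (norm_nonneg a)]
    have h2 := (hg (algebraMap ℝ A r - a)).trans h1
    have e : algebraMap ℝ A r = (r : ℂ) • (1 : A) := by
      rw [Algebra.algebraMap_eq_smul_one, Complex.coe_smul]
    rw [map_sub, e, map_smul, hg1, smul_eq_mul, mul_one] at h2
    have h3 := (Complex.re_le_norm _).trans h2
    simp only [Complex.sub_re, Complex.ofReal_re] at h3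
    linarith
  rw [Complex.le_def]
  exact ⟨hre, him.symm⟩

namespace CircleAction

variable {A : Type u} [CStarAlgebra A] (α : CircleAction A)

/-- There is a state that is invariant under the action. -/
theorem exists_invariant_state [Nontrivial A] [PartialOrder A] [StarOrderedRing A] :
    ∃ φ : A →ₚ[ℂ] ℂ, φ 1 = 1 ∧ (∀ ζ a, φ (α ζ a) = φ a) ∧ ∀ a, ‖φ a‖ ≤ ‖a‖ := by
  -- Averaging a norm-one functional with value `1` at the unit keeps it unital and contractive,
  -- hence positive, and makes it invariant.
  obtain ⟨f, hf, hf1⟩ := exists_dual_vector ℂ (1 : A) (norm_ne_zero_iff.mpr one_ne_zero)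
  have hint : ∀ a, Integrable (fun ζ => f (α ζ a)) haarCircle := fun a =>
    integrable_of_continuous (f.continuous.comp (α.continuous_apply a))
  let g : A →ₗ[ℂ] ℂ :=
    { toFun := fun a => ∫ ζ, f (α ζ a) ∂haarCircle
      map_add' := fun a b => by
        simp only [map_add]
        exact integral_add (hint a) (hint b)
      map_smul' := fun c a => by
        simp only [map_smul, RingHom.id_apply]
        exact integral_smul c _ }
  have hg : ∀ a, ‖g a‖ ≤ ‖a‖ := fun a => by
    have := norm_integral_le_of_norm_le_const (μ := haarCircle) (f := fun ζ => f (α ζ a))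
      (C := ‖a‖) (.of_forall fun ζ => by
        have := f.le_opNorm (α ζ a)
        rwa [hf, one_mul, norm_apply] at this)
    simpa [g] using this
  have hg1 : g 1 = 1 := by
    simp [g, hf1]
  refine ⟨PositiveLinearMap.mk₀ g fun a ha => nonneg_of_norm_le_of_map_one g hg hg1 ha, hg1,
    fun η a => ?_, hg⟩
  have := integral_mul_right_eq_self (μ := haarCircle) (fun ζ => f (α ζ a)) η
  refine Eq.trans ?_ this
  refine integral_congr_ae (.of_forall fun ζ => ?_)
  beta_reduce
  rw [apply_mul_apply]

/-! ### The GNS representation of an invariant state -/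

section GNS

open UniformSpace Completion

variable [PartialOrder A] [StarOrderedRing A] {α} {φ : A →ₚ[ℂ] ℂ}
  (hφ : ∀ ζ a, φ (α ζ a) = φ a)

theorem norm_toPreGNS_apply (hφ : ∀ ζ a, φ (α ζ a) = φ a) (ζ : Circle) (x : φ.PreGNS) :
    ‖φ.toPreGNS (α ζ (φ.ofPreGNS x))‖ = ‖x‖ := by
  rw [φ.preGNS_norm_def, φ.preGNS_norm_def, φ.ofPreGNS_toPreGNS, ← map_star, ← map_mul, hφ]

/-- The isometry of the pre-Hilbert space of an invariant state implementing the action. -/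
noncomputable def preGNSIsometry (ζ : Circle) : φ.PreGNS →L[ℂ] φ.PreGNS :=
  LinearMap.mkContinuous
    (φ.toPreGNS.toLinearMap ∘ₗ (α ζ : A →ₗ[ℂ] A) ∘ₗ φ.ofPreGNS.toLinearMap) 1
    fun x => by rw [one_mul]; exact (norm_toPreGNS_apply hφ ζ x).le

theorem preGNSIsometry_apply (ζ : Circle) (x : φ.PreGNS) :
    preGNSIsometry hφ ζ x = φ.toPreGNS (α ζ (φ.ofPreGNS x)) := rfl

/-- The operator on the Hilbert space of an invariant state implementing the action. -/
noncomputable def gnsIsometry (ζ : Circle) : φ.GNS →L[ℂ] φ.GNS :=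
  (preGNSIsometry hφ ζ).completion

theorem gnsIsometry_coe (ζ : Circle) (x : φ.PreGNS) :
    gnsIsometry hφ ζ (x : φ.GNS) = (φ.toPreGNS (α ζ (φ.ofPreGNS x)) : φ.PreGNS) := by
  simp [gnsIsometry, preGNSIsometry_apply]

theorem gnsIsometry_mul (ζ η : Circle) :
    gnsIsometry hφ (ζ * η) = gnsIsometry hφ ζ * gnsIsometry hφ η := by
  ext x
  induction x using induction_on with
  | hp => apply isClosed_eq <;> fun_prop
  | ih x =>
    rw [mul_apply_eq_comp, gnsIsometry_coe, gnsIsometry_coe, gnsIsometry_coe, apply_mul_apply,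
      φ.ofPreGNS_toPreGNS]

theorem gnsIsometry_one : gnsIsometry hφ 1 = 1 := by
  ext x
  induction x using induction_on with
  | hp => apply isClosed_eq <;> fun_prop
  | ih x =>
    rw [gnsIsometry_coe, map_one]
    rfl

theorem star_gnsIsometry (ζ : Circle) : star (gnsIsometry hφ ζ) = gnsIsometry hφ ζ⁻¹ := by
  rw [ContinuousLinearMap.star_eq_adjoint, eq_comm, ContinuousLinearMap.eq_adjoint_iff]
  intro x y
  induction x, y using induction_on₂ with
  | hp => apply isClosed_eq <;> fun_prop
  | ih x y =>
    rw [gnsIsometry_coe, gnsIsometry_coe, inner_coe, inner_coe, φ.preGNS_inner_def,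
      φ.preGNS_inner_def, φ.ofPreGNS_toPreGNS, φ.ofPreGNS_toPreGNS, ← hφ ζ, map_mul, map_star,
      ← apply_mul_apply, mul_inv_cancel, map_one]
    rfl

/-- The unitary representation on the Hilbert space of an invariant state. -/
noncomputable def gnsUnitaryRep : Circle →* unitary (φ.GNS →L[ℂ] φ.GNS) where
  toFun ζ := ⟨gnsIsometry hφ ζ, Unitary.mem_iff.mpr <| by
    rw [star_gnsIsometry, ← gnsIsometry_mul, ← gnsIsometry_mul, inv_mul_cancel, mul_inv_cancel,
      gnsIsometry_one]
    exact ⟨rfl, rfl⟩⟩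
  map_one' := Subtype.ext (gnsIsometry_one hφ)
  map_mul' ζ η := Subtype.ext (gnsIsometry_mul hφ ζ η)

theorem norm_gnsIsometry_apply (ζ : Circle) (x : φ.GNS) : ‖gnsIsometry hφ ζ x‖ = ‖x‖ :=
  ContinuousLinearMap.norm_map_of_mem_unitary (gnsUnitaryRep hφ ζ).2 x

theorem norm_toPreGNS_le (hφn : ∀ a, ‖φ a‖ ≤ ‖a‖) (a : A) : ‖φ.toPreGNS a‖ ≤ ‖a‖ := by
  rw [φ.preGNS_norm_def, φ.ofPreGNS_toPreGNS]
  refine Real.sqrt_le_iff.mpr ⟨norm_nonneg a, ?_⟩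
  rw [pow_two, ← CStarRing.norm_star_mul_self]
  exact (Complex.re_le_norm _).trans (hφn _)

/-- On the dense image of `A` this follows from norm continuity of orbits. The operators are
isometric, so general orbits are uniform limits of these. -/
theorem continuous_gnsIsometry_apply (hφn : ∀ a, ‖φ a‖ ≤ ‖a‖) (x : φ.GNS) :
    Continuous fun ζ => gnsIsometry hφ ζ x := by
  have hcoe : ∀ y : φ.PreGNS, Continuous fun ζ => gnsIsometry hφ ζ (y : φ.GNS) := by
    intro y
    simp only [gnsIsometry_coe]
    have hc : Continuous φ.toPreGNS :=
      AddMonoidHomClass.continuous_of_bound φ.toPreGNS 1 fun a => by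
        rw [one_mul]; exact norm_toPreGNS_le hφn a
    exact (continuous_coe _).comp (hc.comp (α.continuous_apply _))
  refine continuous_of_uniform_approx_of_continuous fun V hV => ?_
  obtain ⟨ε, hε, hεV⟩ := Metric.mem_uniformity_dist.mp hV
  obtain ⟨y, hy⟩ := Metric.mem_closure_range_iff.mp (denseRange_coe x) ε hε
  refine ⟨fun ζ => gnsIsometry hφ ζ (y : φ.GNS), hcoe y, fun ζ => hεV ?_⟩
  rw [dist_eq_norm, ← map_sub, norm_gnsIsometry_apply, ← dist_eq_norm]
  exact hy

theorem gnsIsometry_covariant (ζ : Circle) (a : A) :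
    gnsIsometry hφ ζ * φ.gnsStarAlgHom a * star (gnsIsometry hφ ζ) =
      φ.gnsStarAlgHom (α ζ a) := by
  rw [star_gnsIsometry]
  ext x
  induction x using induction_on with
  | hp => apply isClosed_eq <;> fun_prop
  | ih x =>
    have hπ : ∀ (b : A) (y : φ.PreGNS),
        φ.gnsStarAlgHom b (y : φ.GNS) = (φ.toPreGNS (b * φ.ofPreGNS y) : φ.PreGNS) :=
      fun b y => φ.gnsNonUnitalStarAlgHom_apply_coe
    rw [mul_apply_eq_comp, mul_apply_eq_comp, gnsIsometry_coe, hπ, hπ, gnsIsometry_coe,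
      φ.ofPreGNS_toPreGNS, φ.ofPreGNS_toPreGNS, map_mul, ← apply_mul_apply, mul_inv_cancel, map_one]
    rfl

end GNS

/-- There is a covariant representation with a nonzero invariant vector. -/
theorem exists_covariantRep_invariant_vector [Nontrivial A] :
    ∃ (ρ : CovariantRep α) (ξ : ρ.H), ξ ≠ 0 ∧ ∀ ζ, (ρ.U ζ : ρ.H →L[ℂ] ρ.H) ξ = ξ := by
  let _ := CStarAlgebra.spectralOrder A
  have := CStarAlgebra.spectralOrderedRing A
  obtain ⟨φ, hφ1, hφ, hφn⟩ := α.exists_invariant_state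
  let ρ : CovariantRep α :=
    { H := φ.GNS
      π := φ.gnsStarAlgHom
      U := gnsUnitaryRep hφ
      continuous_U := continuous_gnsIsometry_apply hφ hφn
      covariant := gnsIsometry_covariant hφ }
  refine ⟨ρ, (φ.toPreGNS 1 : φ.PreGNS), ?_, fun ζ => ?_⟩
  · intro h
    have h1 : ‖((φ.toPreGNS 1 : φ.PreGNS) : φ.GNS)‖ = 0 := by rw [norm_eq_zero]; exact h
    rw [UniformSpace.Completion.norm_coe, φ.preGNS_norm_def, φ.ofPreGNS_toPreGNS] at h1
    simp [hφ1] at h1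
  · refine (gnsIsometry_coe hφ ζ _).trans ?_
    rw [φ.ofPreGNS_toPreGNS, map_one]

end CircleAction

theorem mainTheorem5 {A : Type u} [CStarAlgebra A] (hA : IsPurelyInfiniteSimple A)
    (α : CircleAction A) (hα : α.HasRokhlinProperty) :
    IsPurelyInfiniteSimple α.fixedPoints ∧ IsPurelyInfiniteSimple α.crossedProduct := by
  have : Nontrivial A := hA.1.1
  obtain ⟨v, hv, -⟩ := hα.exists_eigenunitary one_pos ∅
  obtain ⟨s, hs⟩ := hα.exists_orthogonal_isometries_fixedPoints hA
  refine ⟨hα.isPurelyInfiniteSimple_fixedPoints hA,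
    CircleAction.isPurelyInfiniteSimple_crossedProduct hv α.exists_covariantRep_invariant_vector
      -- The stabilization needs isometries indexed by `ℕ × ℤ`; an injective encoding into `ℕ`
      -- preserves the orthogonality relations.
      (hα.exists_mul_mul_eq_one hA) (s := fun p => s (Encodable.encode p)) fun p q => ?_⟩
  simp only [hs, Encodable.encode_inj]
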